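/- Let $Q$ be a finite group with subgroups $F,G$ such that $Q=FG$ and $F\cap G=1$. For $x\in G$, $a\in F$ write $xa=(x\rhd a)(x\lhd a)$ with $x\rhd a\in F$, $x\lhd a\in G$; then $\lhd$ is a right action of $F$ on the set $G$, and $F_x$ denotes the stabilizer of $x\in G$ in $F$. For a field $E$ let $H_E=E^G\# E F$ be the bismash product, the $E$-algebra with basis $\{p_x\# a : x\in G,\ a\in F\}$ and multiplication $(p_x\# a)(p_y\# b)=\delta_{y,\,x\lhd a}\;p_x\# ab$. Let $p$ be a prime and let $R$ be a complete discrete valuation ring with field of fractions $\mathbb K$ and finite residue field $\Bbbk$ of characteristic $p$ (for example, the completion of the ring of integers of a number field at a prime ideal containing $p$). If $\Gamma$ is a finite group, $W$ a finite-dimensional $\Bbbk\Gamma$-module and $m$ the largest divisor of $|\Gamma|$ prime to $p$, the Brauer character $\phi$ of $W$ is the $\mathbb K$-valued function on the set of $p$-regular elements of $\Gamma$ (those of order prime to $p$) whose value at $g$ is the sum of the lifts to $m$-th roots of unity in an algebraic closure of $\mathbb K$ of the eigenvalues of $g$ on $W$, with multiplicity. (Precisely: there is a unique multiset $s$ of $m$-th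 roots of unity in an algebraic closure of $\mathbb K$ such that $\prod_{z\in s}(X-z)$ has coefficients in $R$ and reduces to the characteristic polynomial of $g$ on $W$ over $\Bbbk$, and $\phi(g)=\sum_{z\in s}z\in R$. If $R$ contains a primitive $m$-th root of unity $\omega$ with reduction $\bar\omega$, this means that each eigenvalue $\bar\omega^{\,i}$ is replaced by $\omega^i$.) Fix a set $T$ of representatives of the $F$-orbits of $G$ and, for each $x\in G$, a set $S_x$ of representatives of the cosets $tF_x$ in $F$. For $x\in T$ and a simple $\Bbbk F_x$-module $W$, let $\hat W=\Bbbk F\otimes_{\Bbbk F_x}W$, an $H_\Bbbk$-module by $(p_y\# a)[b\otimes w]=\delta_{y\lhd(ab),\,x}\,[ab\otimes w]$. Let $\mathcal B_{p'}$ be the set of those $p_y\# a$ with $a\in F_y$ (equivalently, $p_y\# a$ is not nilpotent) and $a$ $p$-regular. The Brauer character of an $H_\Bbbk$-module isomorphic to $\hat W$ is the function $$\hat\phi:\mathcal B_{p'}\to\mathbb K,\qquad \hat\phi(p_y\# a)=\sum_{t\in S_x,\ t^{-1}at\in F_x}\delta_{y\lhd t,\,x}\;\phi(t^{-1}at),$$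 where $\phi$ is the Brauer character of the $\Bbbk F_x$-module $W$. Then the irreducible Brauer characters of $H_\Bbbk$ are $\mathbb K$-linearly independent: if $(M_i)_{i\in I}$ is any family of pairwise non-isomorphic simple $H_\Bbbk$-modules, then each $M_i$ has exactly one Brauer character $\hat\phi_i$ in the above sense, and the functions $\hat\phi_i:\mathcal B_{p'}\to\mathbb K$ $(i\in I)$ are linearly independent over $\mathbb K$. -/

import Mathlib

open Polynomial

set_option linter.unusedSectionVars false

section Factorizable

variable {Q : Type*} [Group Q] {F G : Subgroup Q}

/-- For a group `Q` factorized as `Q = FG`, `F ∩ G = 1`, the element `x ◁ a` of `G`, where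
`x * a = (x ▷ a) * (x ◁ a)` with `x ▷ a ∈ F` and `x ◁ a ∈ G`. -/
noncomputable def actR (hQ : F.IsComplement' G) (x : G) (a : F) : G :=
  (hQ.equiv ((x : Q) * (a : Q))).2

theorem actR_eq (hQ : F.IsComplement' G) {x z : G} {a b : F}
    (h : (x : Q) * (a : Q) = (b : Q) * (z : Q)) : actR hQ x a = z := by
  have : hQ.equiv ((x : Q) * (a : Q)) = (b, z) := by
    rw [h, ← Equiv.eq_symm_apply]
    rfl
  unfold actR
  rw [this]

theorem actR_spec (hQ : F.IsComplement' G) (x : G) (a : F) :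
    ∃ b : F, (x : Q) * (a : Q) = (b : Q) * (actR hQ x a : Q) :=
  ⟨_, (hQ.equiv_fst_mul_equiv_snd ((x : Q) * (a : Q))).symm⟩

theorem actR_one (hQ : F.IsComplement' G) (x : G) : actR hQ x 1 = x :=
  actR_eq hQ (b := 1) (by simp)

theorem actR_mul (hQ : F.IsComplement' G) (x : G) (a b : F) :
    actR hQ x (a * b) = actR hQ (actR hQ x a) b := by
  obtain ⟨c, hc⟩ := actR_spec hQ x a
  obtain ⟨d, hd⟩ := actR_spec hQ (actR hQ x a) b
  refine actR_eq hQ (b := c * d) ?_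
  push_cast
  rw [← mul_assoc, hc, mul_assoc, hd, mul_assoc]

theorem actR_actR_inv (hQ : F.IsComplement' G) (x : G) (a : F) :
    actR hQ (actR hQ x a) a⁻¹ = x := by
  rw [← actR_mul, mul_inv_cancel, actR_one]

/-- The stabilizer `F_x` of `x ∈ G` under the right action `◁` of `F` on `G`. -/
def stab (hQ : F.IsComplement' G) (x : G) : Subgroup F where
  carrier := {a | actR hQ x a = x}
  one_mem' := actR_one hQ x
  mul_mem' := by
    intro a b ha hb
    simp only [Set.mem_ofPred_eq] at *
    rw [actR_mul, ha, hb]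
  inv_mem' := by
    intro a ha
    simp only [Set.mem_ofPred_eq] at *
    conv_lhs => rw [← ha]
    exact actR_actR_inv hQ x a

/-- `T` contains exactly one element of every `F`-orbit of `G`. -/
def IsOrbitReps (hQ : F.IsComplement' G) (T : Set G) : Prop :=
  ∀ y : G, ∃! x, x ∈ T ∧ ∃ a : F, actR hQ y a = x

end Factorizable

section BismashAlgebra

variable {Q : Type*} [Group Q] {F G : Subgroup Q} (E : Type*) [Field E]

/-- The underlying space `E^G ⊗ E F` of the bismash product `H_E = E^G # E F` (for `F`, `G`
finite): the function `f` stands for `∑ f x a • (p_x # a)`. Only the algebra structure is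
introduced. -/
@[nolint unusedArguments]
def Bismash (_hQ : F.IsComplement' G) : Type _ := G → F → E

variable {E} (hQ : F.IsComplement' G)

noncomputable instance : AddCommGroup (Bismash E hQ) := inferInstanceAs (AddCommGroup (G → F → E))

noncomputable instance : Module E (Bismash E hQ) := inferInstanceAs (Module E (G → F → E))

/-- The basis element `p_x # a`. -/
noncomputable def Bismash.basis (x : G) (a : F) : Bismash E hQ :=
  open Classical in fun y b => if y = x ∧ b = a then 1 else 0

variable [Fintype F]

/-- The bilinear extension of `(p_x # a)(p_y # b) = δ_{y, x ◁ a} p_x # ab`. -/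
noncomputable instance : Mul (Bismash E hQ) :=
  ⟨fun f g x c => ∑ a : F, f x a * g (actR hQ x a) (a⁻¹ * c)⟩

/-- The unit `∑ p_x # 1`. -/
noncomputable instance : One (Bismash E hQ) :=
  ⟨open Classical in fun _ a => if a = 1 then 1 else 0⟩

theorem Bismash.mul_apply (f g : Bismash E hQ) (x : G) (c : F) :
    (f * g) x c = ∑ a : F, f x a * g (actR hQ x a) (a⁻¹ * c) := rfl

open Classical in
theorem Bismash.one_apply (x : G) (a : F) :
    (1 : Bismash E hQ) x a = if a = 1 then 1 else 0 := rfl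

theorem Bismash.add_apply (f g : Bismash E hQ) (x : G) (c : F) :
    (f + g) x c = f x c + g x c := rfl

theorem Bismash.smul_apply (r : E) (f : Bismash E hQ) (x : G) (c : F) :
    (r • f) x c = r * f x c := rfl

theorem Bismash.zero_apply (x : G) (c : F) : (0 : Bismash E hQ) x c = 0 := rfl

theorem Bismash.ext {f g : Bismash E hQ} (h : ∀ x a, f x a = g x a) : f = g :=
  funext fun x => funext fun a => h x a

noncomputable instance : Ring (Bismash E hQ) :=
  { (inferInstance : AddCommGroup (Bismash E hQ)),
    (inferInstance : Mul (Bismash E hQ)),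
    (inferInstance : One (Bismash E hQ)) with
    left_distrib := by
      intro f g h
      apply Bismash.ext
      intro x c
      simp [Bismash.mul_apply, Bismash.add_apply, mul_add, Finset.sum_add_distrib]
    right_distrib := by
      intro f g h
      apply Bismash.ext
      intro x c
      simp [Bismash.mul_apply, Bismash.add_apply, add_mul, Finset.sum_add_distrib]
    zero_mul := by
      intro f
      apply Bismash.ext
      intro x c
      simp [Bismash.mul_apply, Bismash.zero_apply]
    mul_zero := by
      intro f
      apply Bismash.ext
      intro x c
      simp [Bismash.mul_apply, Bismash.zero_apply]
    one_mul := by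
      intro f
      apply Bismash.ext
      intro x c
      simp [Bismash.mul_apply, Bismash.one_apply, actR_one]
    mul_one := by
      intro f
      apply Bismash.ext
      intro x c
      rw [Bismash.mul_apply, Finset.sum_eq_single c]
      · simp [Bismash.one_apply]
      · intro b _ hb
        have hb' : b⁻¹ * c ≠ 1 := by rwa [Ne, inv_mul_eq_one]
        simp [Bismash.one_apply, hb']
      · simp
    mul_assoc := by
      intro f g h
      apply Bismash.ext
      intro x d
      simp only [Bismash.mul_apply, Finset.sum_mul, Finset.mul_sum]
      rw [Finset.sum_comm]
      refine Finset.sum_congr rfl fun a _ => ?_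
      refine Fintype.sum_equiv (Equiv.mulLeft a⁻¹) _ _ fun c => ?_
      have h1 : actR hQ (actR hQ x a) (a⁻¹ * c) = actR hQ x c := by
        rw [← actR_mul, mul_inv_cancel_left]
      simp [h1, mul_assoc] }

noncomputable instance : Algebra E (Bismash E hQ) :=
  Algebra.ofModule
    (by
      intro r f g
      apply Bismash.ext
      intro x c
      simp [Bismash.mul_apply, Bismash.smul_apply, Finset.mul_sum, mul_assoc])
    (by
      intro r f g
      apply Bismash.ext
      intro x c
      simp [Bismash.mul_apply, Bismash.smul_apply, Finset.mul_sum, mul_left_comm])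

open Classical in
theorem Bismash.basis_mul_basis (x y : G) (a b : F) :
    Bismash.basis hQ x a * Bismash.basis hQ y b =
      if y = actR hQ x a then (Bismash.basis hQ x (a * b) : Bismash E hQ) else 0 := by
  apply Bismash.ext
  intro z c
  rw [Bismash.mul_apply, Finset.sum_eq_single a]
  · by_cases h : y = actR hQ x a
    · by_cases hz : z = x
      · subst hz; simp [Bismash.basis, h, inv_mul_eq_iff_eq_mul]
      · simp [Bismash.basis, h, hz]
    · by_cases hz : z = x
      · subst hz; simp [Bismash.basis, h, Ne.symm h, Bismash.zero_apply]
      · simp [Bismash.basis, h, hz, Bismash.zero_apply]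
  · intro d _ hd
    simp [Bismash.basis, hd]
  · simp

end BismashAlgebra

section InducedModule

variable {Q : Type*} [Group Q] {F G : Subgroup Q} [Fintype F] {E : Type*} [Field E]
  (hQ : F.IsComplement' G) (x : G) (W : Type*) [AddCommGroup W] [Module E W]

/-- The vector space `E F ⊗_E W`: the function `f : F → W` stands for `∑ b ⊗ f b`. -/
@[nolint unusedArguments]
def PreInd (_hQ : F.IsComplement' G) (_x : G) (W : Type*) : Type _ := F → W

noncomputable instance : AddCommGroup (PreInd hQ x W) := inferInstanceAs (AddCommGroup (F → W))

variable {W} in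
theorem PreInd.ext {f g : PreInd hQ x W} (h : ∀ c, f c = g c) : f = g := funext h

variable {W} in
/-- The pure tensor `b ⊗ w`. -/
noncomputable def PreInd.pure (b : F) (w : W) : PreInd hQ x W :=
  open Classical in (Pi.single b w : F → W)

/-- The bilinear extension of `(p_y # a)(b ⊗ w) = δ_{y ◁ (ab), x} (ab ⊗ w)`. -/
noncomputable instance : SMul (Bismash E hQ) (PreInd hQ x W) :=
  ⟨fun h f c => ∑ a : F, h (actR hQ x c⁻¹) a • f (a⁻¹ * c)⟩

variable {W} in
theorem PreInd.smul_apply (h : Bismash E hQ) (f : PreInd hQ x W) (c : F) :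
    (h • f) c = ∑ a : F, h (actR hQ x c⁻¹) a • f (a⁻¹ * c) := rfl

variable {W} in
theorem PreInd.add_apply (f g : PreInd hQ x W) (c : F) : (f + g) c = f c + g c := rfl

noncomputable instance : Module (Bismash E hQ) (PreInd hQ x W) where
  one_smul f := by
    apply PreInd.ext
    intro c
    simp [PreInd.smul_apply, Bismash.one_apply]
  mul_smul g h f := by
    apply PreInd.ext
    intro c
    simp only [PreInd.smul_apply, Bismash.mul_apply, Finset.sum_smul, Finset.smul_sum]
    rw [Finset.sum_comm]
    refine Finset.sum_congr rfl fun a _ => ?_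
    refine Fintype.sum_equiv (Equiv.mulLeft a⁻¹) _ _ fun d => ?_
    simp [actR_mul, mul_smul, mul_assoc]
  smul_zero h := by
    apply PreInd.ext
    intro c
    change ∑ a : F, h (actR hQ x c⁻¹) a • (0 : W) = 0
    simp
  smul_add h f g := by
    apply PreInd.ext
    intro c
    simp [PreInd.smul_apply, PreInd.add_apply, Finset.sum_add_distrib]
  add_smul g h f := by
    apply PreInd.ext
    intro c
    simp [PreInd.smul_apply, PreInd.add_apply, Bismash.add_apply, add_smul,
      Finset.sum_add_distrib]
  zero_smul f := by
    apply PreInd.ext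
    intro c
    change ∑ a : F, (0 : E) • f (a⁻¹ * c) = 0
    simp

variable {W} in
open Classical in
theorem PreInd.basis_smul_pure (y : G) (a b : F) (w : W) :
    (Bismash.basis hQ y a : Bismash E hQ) • PreInd.pure hQ x b w =
      if actR hQ y (a * b) = x then PreInd.pure hQ x (a * b) w else 0 := by
  apply PreInd.ext
  intro c
  have key : ∀ c : F, actR hQ x c⁻¹ = y ↔ actR hQ y c = x := by
    intro c
    constructor
    · rintro rfl
      rw [← actR_mul, inv_mul_cancel, actR_one]
    · rintro rfl
      exact actR_actR_inv hQ y c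
  rw [PreInd.smul_apply, Finset.sum_eq_single a]
  · by_cases hc : c = a * b
    · subst hc
      by_cases h : actR hQ y (a * b) = x
      · have h' := (key (a * b)).2 h
        rw [mul_inv_rev] at h'
        simp [Bismash.basis, PreInd.pure, h, h']
      · have h' : actR hQ x (a * b)⁻¹ ≠ y := fun e => h ((key _).1 e)
        rw [mul_inv_rev] at h'
        simp [Bismash.basis, PreInd.pure, h, h']
        rfl
    · have h1 : a⁻¹ * c ≠ b := by rwa [Ne, inv_mul_eq_iff_eq_mul]
      by_cases h : actR hQ y (a * b) = x
      · simp [PreInd.pure, h, h1, hc]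
      · simp [PreInd.pure, h, h1]
        rfl
  · intro d _ hd
    simp [Bismash.basis, hd]
  · simp

variable {x W}

/-- The relations `bs ⊗ w = b ⊗ sw` (`s ∈ F_x`). Their span over `H_E` is their span over `E`,
as each `p_y # a` sends a relation to a relation or to zero. -/
noncomputable def indRelations (ρ : Representation E (stab hQ x) W) :
    Submodule (Bismash E hQ) (PreInd hQ x W) :=
  Submodule.span _ {v | ∃ (b : F) (s : stab hQ x) (w : W),
    v = PreInd.pure hQ x (b * s) w - PreInd.pure hQ x b (ρ s w)}

/-- The `H_E`-module `Ŵ = E F ⊗_{E F_x} W`, where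
`(p_y # a)[b ⊗ w] = δ_{y ◁ (ab), x} [ab ⊗ w]`. -/
abbrev IndModule (ρ : Representation E (stab hQ x) W) : Type _ :=
  PreInd hQ x W ⧸ indRelations hQ ρ

end InducedModule

section GroupBrauer

variable {R : Type*} (K : Type*) [CommRing R] [IsLocalRing R] [Field K] [Algebra R K]

/-- For a monic polynomial `q` over the residue field `k` of `R`, all of whose roots are `m`-th
roots of unity (`m` invertible in `k`), `s` is the multiset of the roots of `q` lifted to `m`-th
roots of unity in an algebraic closure of `K`: the monic polynomial with roots `s` has its
coefficients in `R`, and its reduction is `q`. If all roots of `q` are powers `ω̄ ^ i` of the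
reduction of a primitive `m`-th root of unity `ω ∈ R`, then `s` consists of the `ω ^ i`. -/
def IsRootLift (m : ℕ) (q : (IsLocalRing.ResidueField R)[X])
    (s : Multiset (AlgebraicClosure K)) : Prop :=
  (∀ z ∈ s, z ^ m = 1) ∧
    ∃ P : R[X], P.map ((algebraMap K (AlgebraicClosure K)).comp (algebraMap R K)) =
        (s.map fun z => X - C z).prod ∧
      P.map (IsLocalRing.residue R) = q

/-- The sum (in `K`, as minus the second coefficient of a polynomial over `R`) of the lifts of the
roots of `q` to `m`-th roots of unity. -/
noncomputable def liftedRootSum (m : ℕ) (q : (IsLocalRing.ResidueField R)[X]) : K :=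
  open Classical in
  if h : ∃ v : K, ∃ s : Multiset (AlgebraicClosure K),
      IsRootLift K m q s ∧ algebraMap K (AlgebraicClosure K) v = s.sum
  then h.choose else 0

/-- The `p`-regular elements of a group: those of finite order prime to `p`. -/
def PRegular (p : ℕ) (Γ : Type*) [Group Γ] : Type _ :=
  {g : Γ // IsOfFinOrder g ∧ (orderOf g).Coprime p}

/-- The Brauer character of a finite group `Γ` afforded by a finite-dimensional representation
over the residue field `k` of `R`: its value at `g` is the sum of the lifts of the eigenvalues
of `g`, taken with multiplicity, to roots of unity of order dividing the `p'`-part of `|Γ|`. -/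
noncomputable def groupBrauerCharacter (p : ℕ) {Γ : Type*} [Group Γ] {W : Type*} [AddCommGroup W]
    [Module (IsLocalRing.ResidueField R) W] [Module.Finite (IsLocalRing.ResidueField R) W]
    (ρ : Representation (IsLocalRing.ResidueField R) Γ W) (g : PRegular p Γ) : K :=
  liftedRootSum K (ordCompl[p] (Nat.card Γ)) (LinearMap.charpoly (ρ g.1))

end GroupBrauer

section BismashBrauer

variable {Q : Type*} [Group Q] {F G : Subgroup Q}

/-- The set `B_{p'}` of the basis elements `p_y # a` (recorded as pairs) with `a ∈ F_y`, that is,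
`p_y # a` not nilpotent, and `a` `p`-regular. -/
def BPrime (p : ℕ) (hQ : F.IsComplement' G) : Type _ :=
  {w : G × F // w.2 ∈ stab hQ w.1 ∧ IsOfFinOrder w.2 ∧ (orderOf w.2).Coprime p}

theorem pRegular_conj {p : ℕ} {Γ : Type*} [Group Γ] {A : Subgroup Γ} {a t : Γ}
    (h : t⁻¹ * a * t ∈ A) (ha : IsOfFinOrder a ∧ (orderOf a).Coprime p) :
    IsOfFinOrder (⟨t⁻¹ * a * t, h⟩ : A) ∧ (orderOf (⟨t⁻¹ * a * t, h⟩ : A)).Coprime p := by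
  have e : orderOf (⟨t⁻¹ * a * t, h⟩ : A) = orderOf a := by
    rw [← Subgroup.orderOf_coe]
    have := (MulAut.conj t⁻¹).orderOf_eq a
    simpa using this
  refine ⟨?_, e ▸ ha.2⟩
  rw [← orderOf_pos_iff, e, orderOf_pos_iff]
  exact ha.1

variable (R : Type*) (K : Type*) [CommRing R] [IsLocalRing R] [Field K] [Algebra R K]

variable {R} in
/-- The Brauer character of `Ŵ`, for a representation `W` of `F_x` with Brauer character `φ`:
`φ̂(p_y # a) = ∑ δ_{y ◁ t, x} φ(t⁻¹ a t)`, the sum over those `t` in a given set `S` of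
representatives of the cosets `t F_x` for which `t⁻¹ a t ∈ F_x`. -/
noncomputable def bismashBrauerCharacter (p : ℕ) (hQ : F.IsComplement' G) {x : G} (S : Finset F)
    {W : Type*} [AddCommGroup W]
    [Module (IsLocalRing.ResidueField R) W] [Module.Finite (IsLocalRing.ResidueField R) W]
    (ρ : Representation (IsLocalRing.ResidueField R) (stab hQ x) W) (w : BPrime p hQ) : K :=
  open Classical in
  ∑ t ∈ S,
    if h : t⁻¹ * w.1.2 * t ∈ stab hQ x then
      if actR hQ w.1.1 t = x then
        groupBrauerCharacter K p ρ ⟨⟨t⁻¹ * w.1.2 * t, h⟩, pRegular_conj h w.2.2⟩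
      else 0
    else 0

/-- `φ` is the Brauer character of the `H_k`-module `M`: there are a chosen orbit representative
`x ∈ T` and an irreducible (matrix) representation `W` of `F_x` over `k` with `M ≅ Ŵ` and
`φ = φ̂` the function attached to `W`. Here `S x` is the chosen set of representatives of the
cosets of `F_x` in `F`. -/
def IsBrauerCharacter [Fintype F] (p : ℕ) (hQ : F.IsComplement' G) (T : Set G) (S : G → Finset F)
    (M : Type*) [AddCommGroup M] [Module (Bismash (IsLocalRing.ResidueField R) hQ) M]
    (φ : BPrime p hQ → K) : Prop :=
  ∃ x ∈ T, ∃ (n : ℕ) (ρ : Representation (IsLocalRing.ResidueField R) (stab hQ x)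
      (Fin n → IsLocalRing.ResidueField R)),
    ρ.IsIrreducible ∧
    Nonempty (IndModule hQ ρ ≃ₗ[Bismash (IsLocalRing.ResidueField R) hQ] M) ∧
    φ = bismashBrauerCharacter K p hQ (S x) ρ

end BismashBrauer

/-!
# Linear independence of the irreducible Brauer characters of a bismash product

Write `k` for the residue field and `H` for the bismash product over `k`.

*Simple modules.* For a simple `H`-module `M` some orbit representative `x` has `p_x M ≠ 0`, and
`p_x M` is a representation of `F_x` through `s ↦ p_x # s`. It is irreducible, because
`p_x H p_x` is spanned by the `p_x # s`, and the map `b ⊗ w ↦ (p_{x ◁ b⁻¹} # b) w` is an isomorphism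
from the module induced from `p_x M` onto `M` (`exists_isWeightEmbedding`,
`IsWeightEmbedding.isIrreducible`, `IsWeightEmbedding.nonempty_equiv`). Conversely `Ŵ` determines
`x` and `W` (`eq_of_indModule_equiv`, `exists_equiv_of_indModule_equiv`). To compute in the quotient
`Ŵ`, it is embedded into `kF ⊗ W` by the map `coindMap`, which sums over `F_x`. Hence every
simple module has exactly one Brauer character.

*Reduction to traces.* A matrix over `k` of order dividing `m`, with `m` prime to `p`, lifts to a
matrix over the complete ring `R` of order dividing `m`: the powers `B ^ (p ^ (φ(m) j))` of an
arbitrary lift `B` converge to one (`exists_matrix_pow_eq_one`). Its characteristic polynomial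
exhibits the lifted eigenvalues, so Brauer characters take values in `R` and reduce to traces
(`exists_residue_eq_trace_groupBrauerCharacter`). A nontrivial relation between Brauer characters
over the field of fractions can be scaled to have coefficients in `R`, one of them equal to `1`; its
reduction is a nontrivial relation over `k`. Evaluated at the `p_x # a` with `a ∈ F_x`, it becomes
a relation between the traces of pairwise inequivalent irreducible representations of the group
`F_x` on `p`-regular elements.

*Independence of traces.* Such a relation extends from `p`-regular elements to the whole group
algebra, because `tr(f ^ q) = tr(f)` over the field with `q` elements and a high `q ^ N`-th power of
a group element is `p`-regular. By Wedderburn's theorem the endomorphism ring `D` of a simple module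
`V` over a `k`-algebra is a finite field, hence separable over `k`, and so there is a
`D`-linear endomorphism of `V` of nonzero `k`-trace. By the density theorem some element of the
algebra acts as this endomorphism on `V` and as zero on the other simple modules involved
(`exists_trace_ne_zero_of_simple`).
-/

/-! ### Lifting matrices of finite order prime to the residue characteristic -/

section MatrixLift

variable {R : Type*} [CommRing R] {n : Type*} [Fintype n] [DecidableEq n]

theorem mapMatrix_mk_eq_iff (J : Ideal R) (x y : Matrix n n R) :
    (Ideal.Quotient.mk J).mapMatrix x = (Ideal.Quotient.mk J).mapMatrix y ↔
      ∀ a b, x a b - y a b ∈ J := by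
  simp only [← Matrix.ext_iff, RingHom.mapMatrix_apply, Matrix.map_apply, Ideal.Quotient.eq]

theorem mapMatrix_mk_pow_succ_of_eq_one {I : Ideal R} {p : ℕ} (hp : (p : R) ∈ I) (j : ℕ)
    {x : Matrix n n R} (hx : (Ideal.Quotient.mk (I ^ (j + 1))).mapMatrix x = 1) :
    (Ideal.Quotient.mk (I ^ (j + 2))).mapMatrix (x ^ p) = 1 := by
  have hx' : ∀ a b, (x - 1) a b ∈ I ^ (j + 1) := by
    rw [← map_one (Ideal.Quotient.mk (I ^ (j + 1))).mapMatrix, mapMatrix_mk_eq_iff] at hx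
    exact hx
  have hx1 : (Ideal.Quotient.mk I).mapMatrix x = 1 := by
    rw [← map_one (Ideal.Quotient.mk I).mapMatrix, mapMatrix_mk_eq_iff]
    exact fun a b => Ideal.pow_le_self (Nat.succ_ne_zero j) (hx' a b)
  -- `1 + x + ⋯ + x ^ (p - 1)` reduces to `p = 0` modulo `I`.
  have hs : ∀ a b, (∑ i ∈ Finset.range p, x ^ i) a b ∈ I := by
    have : (Ideal.Quotient.mk I).mapMatrix (∑ i ∈ Finset.range p, x ^ i) =
        (Ideal.Quotient.mk I).mapMatrix 0 := by
      rw [map_sum, map_zero]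
      simp only [map_pow, hx1, one_pow, Finset.sum_const, Finset.card_range, nsmul_eq_mul, mul_one]
      rw [← map_natCast (Matrix.scalar n), ← map_natCast (Ideal.Quotient.mk I),
        Ideal.Quotient.eq_zero_iff_mem.2 hp, map_zero]
    rw [mapMatrix_mk_eq_iff] at this
    simpa using this
  rw [← map_one (Ideal.Quotient.mk (I ^ (j + 2))).mapMatrix, mapMatrix_mk_eq_iff]
  intro a b
  rw [← Matrix.sub_apply, ← mul_geom_sum, Matrix.mul_apply]
  exact Ideal.sum_mem _ fun c _ => by
    rw [show I ^ (j + 2) = I ^ (j + 1) * I from pow_succ I (j + 1)]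
    exact Ideal.mul_mem_mul (hx' a c) (hs c b)

theorem mapMatrix_mk_pow_of_eq_one {I : Ideal R} {p : ℕ} (hp : (p : R) ∈ I)
    {x : Matrix n n R} (hx : (Ideal.Quotient.mk I).mapMatrix x = 1) (j : ℕ) :
    (Ideal.Quotient.mk (I ^ (j + 1))).mapMatrix (x ^ p ^ j) = 1 := by
  induction j with
  | zero =>
    rw [← map_one (Ideal.Quotient.mk I).mapMatrix, mapMatrix_mk_eq_iff] at hx
    rw [← map_one (Ideal.Quotient.mk (I ^ (0 + 1))).mapMatrix, mapMatrix_mk_eq_iff]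
    simpa using hx
  | succ j ih =>
    rw [pow_succ p, pow_mul]
    exact mapMatrix_mk_pow_succ_of_eq_one hp j ih

theorem mapMatrix_mk_of_le {I J : Ideal R} (h : I ≤ J) {x y : Matrix n n R}
    (hx : (Ideal.Quotient.mk I).mapMatrix x = (Ideal.Quotient.mk I).mapMatrix y) :
    (Ideal.Quotient.mk J).mapMatrix x = (Ideal.Quotient.mk J).mapMatrix y := by
  rw [mapMatrix_mk_eq_iff] at hx ⊢
  exact fun a b => h (hx a b)

/-- A matrix over an `I`-adically complete ring whose `m`-th power is congruent to `1` modulo `I`,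
where `m` is prime to a prime number `p ∈ I`, is congruent to a matrix with `m`-th power `1`. As for
Teichmüller representatives, the latter is the limit of the powers with exponents
`p ^ (φ(m) j)`. -/
theorem exists_matrix_pow_eq_one {I : Ideal R} [IsAdicComplete I R] {p : ℕ} [hpp : Fact p.Prime]
    (hp : (p : R) ∈ I) {m : ℕ} (hm : m.Coprime p) {x : Matrix n n R}
    (hx : (Ideal.Quotient.mk I).mapMatrix (x ^ m) = 1) :
    ∃ y : Matrix n n R, y ^ m = 1 ∧
      (Ideal.Quotient.mk I).mapMatrix y = (Ideal.Quotient.mk I).mapMatrix x := by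
  have hm0 : m ≠ 0 := by
    rintro rfl
    exact hpp.out.ne_one ((Nat.coprime_zero_left p).1 hm)
  set u := m.totient with hu
  have hupos : 0 < u := Nat.totient_pos.2 (Nat.pos_of_ne_zero hm0)
  obtain ⟨t, ht⟩ : m ∣ p ^ u - 1 :=
    (Nat.modEq_iff_dvd' (Nat.one_le_pow _ _ hpp.out.pos)).1 (Nat.ModEq.pow_totient hm.symm).symm
  have ht' : p ^ u = 1 + m * t := by
    have := Nat.one_le_pow u p hpp.out.pos
    omega
  have hone : ∀ j s, (Ideal.Quotient.mk (I ^ (j + 1))).mapMatrix ((x ^ (m * s)) ^ p ^ (u * j)) =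
      (Ideal.Quotient.mk (I ^ (j + 1))).mapMatrix 1 := by
    intro j s
    have h1 : (Ideal.Quotient.mk I).mapMatrix (x ^ (m * s)) = 1 := by
      rw [pow_mul, map_pow, hx, one_pow]
    refine mapMatrix_mk_of_le (I := I ^ (u * j + 1))
      (Ideal.pow_le_pow_right (Nat.succ_le_succ (Nat.le_mul_of_pos_left j hupos))) ?_
    rw [mapMatrix_mk_pow_of_eq_one hp h1, map_one]
  have hstep : ∀ j, (Ideal.Quotient.mk (I ^ (j + 1))).mapMatrix (x ^ p ^ (u * (j + 1))) =
      (Ideal.Quotient.mk (I ^ (j + 1))).mapMatrix (x ^ p ^ (u * j)) := by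
    intro j
    have e : x ^ p ^ (u * (j + 1)) = x ^ p ^ (u * j) * (x ^ (m * t)) ^ p ^ (u * j) := by
      rw [← pow_mul, ← pow_add]
      congr 1
      rw [mul_add, mul_one, pow_add, ht']
      ring
    rw [e, map_mul, hone, map_one, mul_one]
  have hmono : ∀ {i j : ℕ}, i ≤ j → (Ideal.Quotient.mk (I ^ i)).mapMatrix (x ^ p ^ (u * i)) =
      (Ideal.Quotient.mk (I ^ i)).mapMatrix (x ^ p ^ (u * j)) := by
    intro i j hij
    induction j, hij using Nat.le_induction with
    | base => rfl
    | succ j hij ih =>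
      rw [ih]
      exact (mapMatrix_mk_of_le (Ideal.pow_le_pow_right (hij.trans (Nat.le_succ j)))
        (hstep j)).symm
  have hlim : ∀ a b, ∃ l : R, ∀ i, (x ^ p ^ (u * i)) a b ≡ l [SMOD (I ^ i • ⊤ : Ideal R)] := by
    intro a b
    refine IsPrecomplete.prec' (fun i => (x ^ p ^ (u * i)) a b) fun {i j} hij => ?_
    rw [smul_eq_mul, Ideal.mul_top, SModEq.sub_mem]
    exact (mapMatrix_mk_eq_iff _ _ _).1 (hmono hij) a b
  choose l hl using hlim
  have hy : ∀ i, (Ideal.Quotient.mk (I ^ i)).mapMatrix (x ^ p ^ (u * i)) =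
      (Ideal.Quotient.mk (I ^ i)).mapMatrix (Matrix.of l) := by
    intro i
    rw [mapMatrix_mk_eq_iff]
    intro a b
    have := hl a b i
    rwa [smul_eq_mul, Ideal.mul_top, SModEq.sub_mem] at this
  refine ⟨Matrix.of l, ?_, ?_⟩
  · ext a b
    rw [← sub_eq_zero]
    refine IsHausdorff.haus (I := I) inferInstance _ fun i => ?_
    rw [smul_eq_mul, Ideal.mul_top, SModEq.sub_mem, sub_zero]
    refine (mapMatrix_mk_eq_iff _ _ _).1 ?_ a b
    rw [map_pow, ← hy, ← map_pow, pow_right_comm]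
    have := hone i 1
    rw [mul_one] at this
    exact mapMatrix_mk_of_le (Ideal.pow_le_pow_right (Nat.le_succ i)) this
  · have h := (hy 1).symm.trans (hstep 0)
    rw [mul_zero, pow_zero, pow_one x] at h
    exact mapMatrix_mk_of_le (Ideal.pow_le_self one_ne_zero) h

end MatrixLift

/-! ### Brauer characters of groups reduce to traces -/

section GroupBrauerReduction

variable {R : Type*} (K : Type*) [CommRing R] [IsLocalRing R] [Field K] [Algebra R K]

theorem exists_isRootLift_charpoly [IsAdicComplete (IsLocalRing.maximalIdeal R) R] {p : ℕ}
    [Fact p.Prime] [CharP (IsLocalRing.ResidueField R) p] {m : ℕ} (hm : m.Coprime p)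
    {n : Type*} [Fintype n] [DecidableEq n] (b : Matrix n n (IsLocalRing.ResidueField R))
    (hb : b ^ m = 1) : ∃ s, IsRootLift K m b.charpoly s := by
  have hp : (p : R) ∈ IsLocalRing.maximalIdeal R := by
    rw [← IsLocalRing.residue_eq_zero_iff, map_natCast, CharP.cast_eq_zero]
  obtain ⟨x, rfl⟩ : ∃ x : Matrix n n R, (IsLocalRing.residue R).mapMatrix x = b := by
    choose f hf using fun i j => IsLocalRing.residue_surjective (b i j)
    exact ⟨Matrix.of f, by ext i j; simp [hf]⟩
  obtain ⟨y, hy, hyx⟩ := exists_matrix_pow_eq_one hp hm (x := x)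
    (by rw [map_pow]; exact hb)
  replace hyx : (IsLocalRing.residue R).mapMatrix y = (IsLocalRing.residue R).mapMatrix x := hyx
  set g := (algebraMap K (AlgebraicClosure K)).comp (algebraMap R K)
  have hyg : (g.mapMatrix y) ^ m = 1 := by rw [← map_pow, hy, map_one]
  refine ⟨(g.mapMatrix y).charpoly.roots, fun z hz => ?_, y.charpoly, ?_, ?_⟩
  · have hz' : z ∈ spectrum (AlgebraicClosure K) (g.mapMatrix y) :=
      Matrix.mem_spectrum_iff_isRoot_charpoly.2 (isRoot_of_mem_roots hz)
    have hn : Nontrivial (Matrix n n (AlgebraicClosure K)) := by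
      by_contra hn
      rw [not_nontrivial_iff_subsingleton] at hn
      rw [spectrum.of_subsingleton] at hz'
      exact hz'
    have := spectrum.pow_mem_pow _ m hz'
    rwa [hyg, spectrum.one_eq, Set.mem_singleton_iff] at this
  · rw [← Matrix.charpoly_map, ← RingHom.mapMatrix_apply]
    exact (IsAlgClosed.splits _).eq_prod_roots_of_monic (Matrix.charpoly_monic _)
  · rw [← Matrix.charpoly_map, ← RingHom.mapMatrix_apply, hyx]

variable [IsFractionRing R K]

theorem IsRootLift.sum_eq {m : ℕ} {q : (IsLocalRing.ResidueField R)[X]}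
    {s : Multiset (AlgebraicClosure K)} (h : IsRootLift K m q s) :
    ∃ r : R, algebraMap K (AlgebraicClosure K) (algebraMap R K r) = s.sum ∧
      IsLocalRing.residue R r = -q.nextCoeff := by
  obtain ⟨-, P, hP, rfl⟩ := h
  have hinj : Function.Injective ((algebraMap K (AlgebraicClosure K)).comp (algebraMap R K)) :=
    (algebraMap K (AlgebraicClosure K)).injective.comp (IsFractionRing.injective R K)
  have hmon : P.Monic := by
    refine Polynomial.monic_of_injective hinj ?_
    rw [hP]
    exact monic_multiset_prod_of_monic _ _ fun z _ => monic_X_sub_C z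
  refine ⟨-P.nextCoeff, ?_, ?_⟩
  · have := congrArg nextCoeff hP
    rw [nextCoeff_map hinj, multiset_prod_X_sub_C_nextCoeff, RingHom.comp_apply] at this
    rw [map_neg, map_neg, this, neg_neg]
  · rw [map_neg, nextCoeff, nextCoeff, hmon.natDegree_map]
    split_ifs <;> simp

theorem exists_residue_eq_neg_nextCoeff_of_isRootLift {m : ℕ}
    {q : (IsLocalRing.ResidueField R)[X]} {s : Multiset (AlgebraicClosure K)}
    (h : IsRootLift K m q s) :
    ∃ r : R, algebraMap R K r = liftedRootSum K m q ∧
      IsLocalRing.residue R r = -q.nextCoeff := by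
  have hex : ∃ v : K, ∃ s : Multiset (AlgebraicClosure K),
      IsRootLift K m q s ∧ algebraMap K (AlgebraicClosure K) v = s.sum := by
    obtain ⟨r, hr, -⟩ := h.sum_eq
    exact ⟨_, s, h, hr⟩
  rw [liftedRootSum, dif_pos hex]
  obtain ⟨s', hs', hv⟩ := hex.choose_spec
  obtain ⟨r, hr, hres⟩ := hs'.sum_eq
  exact ⟨r, (algebraMap K (AlgebraicClosure K)).injective (hr.trans hv.symm), hres⟩

/-- The values of a Brauer character lie in `R` and reduce to the traces of the `p`-regular
elements. -/
theorem exists_residue_eq_trace_groupBrauerCharacter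
    [IsAdicComplete (IsLocalRing.maximalIdeal R) R] {p : ℕ}
    [hpp : Fact p.Prime] [CharP (IsLocalRing.ResidueField R) p] {Γ : Type*} [Group Γ] [Finite Γ]
    {W : Type*} [AddCommGroup W] [Module (IsLocalRing.ResidueField R) W]
    [Module.Finite (IsLocalRing.ResidueField R) W]
    (ρ : Representation (IsLocalRing.ResidueField R) Γ W) (g : PRegular p Γ) :
    ∃ r : R, algebraMap R K r = groupBrauerCharacter K p ρ g ∧
      IsLocalRing.residue R r = LinearMap.trace _ W (ρ g.1) := by
  have hm : (ordCompl[p] (Nat.card Γ)).Coprime p :=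
    (Nat.coprime_ordCompl hpp.out Nat.card_pos.ne').symm
  have hord : orderOf g.1 ∣ ordCompl[p] (Nat.card Γ) := by
    refine (Nat.Coprime.pow_right ((Nat.card Γ).factorization p) g.2.2).dvd_of_dvd_mul_left ?_
    rw [Nat.ordProj_mul_ordCompl_eq_self]
    exact orderOf_dvd_natCard g.1
  have hg : g.1 ^ ordCompl[p] (Nat.card Γ) = 1 := orderOf_dvd_iff_pow_eq_one.1 hord
  let b := Module.finBasis (IsLocalRing.ResidueField R) W
  have hb : (LinearMap.toMatrixAlgEquiv b (ρ g.1)) ^ ordCompl[p] (Nat.card Γ) = 1 := by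
    rw [← map_pow, ← map_pow, hg, map_one, map_one]
  have hchar : (LinearMap.toMatrixAlgEquiv b (ρ g.1)).charpoly = (ρ g.1).charpoly :=
    LinearMap.charpoly_toMatrix _ b
  obtain ⟨s, hs⟩ := exists_isRootLift_charpoly K hm _ hb
  obtain ⟨r, hr, hres⟩ := exists_residue_eq_neg_nextCoeff_of_isRootLift K hs
  rw [hchar] at hr
  refine ⟨r, hr, ?_⟩
  rw [hres, ← Matrix.trace_eq_neg_charpoly_nextCoeff, LinearMap.trace_eq_matrix_trace _ b]
  rfl

end GroupBrauerReduction

/-! ### Independence of traces of simple modules over a finite field -/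

section Traces

theorem exists_trace_restrictScalars_ne_zero (k D V : Type*) [Field k] [Finite k] [Field D]
    [Finite D] [Algebra k D] [AddCommGroup V] [Module k V] [Module D V] [IsScalarTower k D V]
    [Module.Finite k V] [Nontrivial V] :
    ∃ f : V →ₗ[D] V, LinearMap.trace k V (f.restrictScalars k) ≠ 0 := by
  have : Module.Finite D V := Module.Finite.of_restrictScalars_finite k D V
  have : Module.Finite k D := Module.Finite.of_finite
  let b := Module.finBasis D V
  have : Nonempty (Fin (Module.finrank D V)) := ⟨⟨0, Module.finrank_pos⟩⟩
  obtain ⟨i⟩ := this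
  obtain ⟨d, hd⟩ := Algebra.trace_surjective k D 1
  -- `f` has rank one over `D` and `D`-trace `d`.
  refine ⟨(LinearMap.toSpanSingleton D V (b i)).comp (d • b.coord i), ?_⟩
  have e : (((LinearMap.toSpanSingleton D V (b i)).comp (d • b.coord i)).restrictScalars k) =
      ((LinearMap.toSpanSingleton D V (b i)).restrictScalars k).comp
        ((d • b.coord i).restrictScalars k) := rfl
  have e' : ((d • b.coord i).restrictScalars k).comp
      ((LinearMap.toSpanSingleton D V (b i)).restrictScalars k) = Algebra.lmul k D d := by
    ext c
    simp
  rw [e, LinearMap.trace_comp_comm', e']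
  change Algebra.trace k D d ≠ 0
  rw [hd]
  exact one_ne_zero

variable {k A : Type*} [Field k] [Finite k] [Ring A] [Algebra k A]

/-- A simple module `V` over an algebra over a finite field has an endomorphism of nonzero trace
commuting with `End_A(V)`, as the latter is a finite field by Wedderburn's theorem and hence
separable over the base field. -/
theorem exists_moduleEnd_trace_ne_zero (V : Type*) [AddCommGroup V] [Module k V] [Module A V]
    [IsScalarTower k A V] [Module.Finite k V] [IsSimpleModule A V] :
    ∃ f : V →ₗ[k] V, (∀ (g : V →ₗ[A] V) v, f (g v) = g (f v)) ∧ LinearMap.trace k V f ≠ 0 := by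
  classical
  have : Finite V := Module.finite_of_finite k
  have : Finite (Module.End A V) := DFunLike.finite _
  have : Nontrivial V := IsSimpleModule.nontrivial A V
  let _ : Field (Module.End A V) := littleWedderburn (Module.End A V)
  obtain ⟨f, hf⟩ := exists_trace_restrictScalars_ne_zero k (Module.End A V) V
  exact ⟨f.restrictScalars k, fun g v => f.map_smul g v, hf⟩

/-- By the density theorem, an element of `A` acts on one of finitely many pairwise non-isomorphic
simple modules as an endomorphism of nonzero trace and annihilates the others. -/
theorem exists_trace_ne_zero_of_simple {ι : Type*} [Finite ι] (V : ι → Type*)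
    [∀ i, AddCommGroup (V i)] [∀ i, Module k (V i)] [∀ i, Module A (V i)]
    [∀ i, IsScalarTower k A (V i)] [∀ i, Module.Finite k (V i)] [∀ i, IsSimpleModule A (V i)]
    (hV : ∀ i j, i ≠ j → IsEmpty (V i ≃ₗ[A] V j)) (i : ι) :
    ∃ a : A, LinearMap.trace k (V i) (Algebra.lsmul k k (V i) a) ≠ 0 ∧
      ∀ j, j ≠ i → ∀ v : V j, a • v = 0 := by
  classical
  have := Fintype.ofFinite ι
  obtain ⟨f, hf, htr⟩ := exists_moduleEnd_trace_ne_zero (k := k) (A := A) (V i)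
  have hschur : ∀ {j l : ι}, j ≠ l → ∀ (h : V j →ₗ[A] V l) v, h v = 0 := by
    intro j l hjl h v
    rcases LinearMap.bijective_or_eq_zero h with hb | h0
    · exact ((hV j l hjl).false (LinearEquiv.ofBijective h hb)).elim
    · rw [h0, LinearMap.zero_apply]
  have hg1 : ∀ (g : Module.End A (Π j, V j)) (v : Π j, V j),
      (g v) i = (g (Pi.single i (v i))) i := by
    intro g v
    conv_lhs => rw [← Finset.univ_sum_single v]
    rw [map_sum, Finset.sum_apply, Finset.sum_eq_single i]
    · intro j _ hj
      exact hschur hj ((LinearMap.proj i).comp (g.comp (LinearMap.single A V j))) (v j)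
    · simp
  have hg2 : ∀ (g : Module.End A (Π j, V j)) (w : V i),
      g (Pi.single i w) = Pi.single i (g (Pi.single i w) i) := by
    intro g w
    ext j
    by_cases hj : j = i
    · subst hj
      simp
    · rw [Pi.single_eq_of_ne hj]
      exact hschur (Ne.symm hj) ((LinearMap.proj j).comp (g.comp (LinearMap.single A V i))) w
  let φ : Module.End (Module.End A (Π j, V j)) (Π j, V j) :=
    { toFun := fun v => Pi.single i (f (v i))
      map_add' := fun v w => by rw [Pi.add_apply, map_add, Pi.single_add]
      map_smul' := fun g v => by
        rw [RingHom.id_apply, Module.End.smul_def, Module.End.smul_def, hg1, hg2 g (f (v i))]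
        congr 1
        exact hf ((LinearMap.proj i).comp (g.comp (LinearMap.single A V i))) (v i) }
  have : ∀ j, Finite (V j) := fun j => Module.finite_of_finite k
  have := Fintype.ofFinite (Π j, V j)
  obtain ⟨a, ha⟩ := jacobson_density φ Finset.univ
  refine ⟨a, ?_, fun j hj v => ?_⟩
  · have : Algebra.lsmul k k (V i) a = f := by
      ext v
      have := congrFun (ha (Pi.single i v) (Finset.mem_univ _)) i
      simpa [φ] using this.symm
    rwa [this]
  · have := congrFun (ha (Pi.single j v) (Finset.mem_univ _)) j
    simpa [φ, hj] using this.symm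

end Traces

section GroupTraces

variable {k : Type*} [Field k] [Finite k] {Γ : Type*} [Group Γ]

theorem trace_pow_card_pow {V : Type*} [AddCommGroup V] [Module k V] [Module.Finite k V]
    (f : Module.End k V) (N : ℕ) :
    LinearMap.trace k V (f ^ Nat.card k ^ N) = LinearMap.trace k V f := by
  have := Fintype.ofFinite k
  have h1 : ∀ f : Module.End k V,
      LinearMap.trace k V (f ^ Nat.card k) = LinearMap.trace k V f := by
    intro f
    let b := Module.finBasis k V
    have h := FiniteField.trace_pow_card (LinearMap.toMatrixAlgEquiv b f)
    rw [← map_pow, FiniteField.pow_card, ← Nat.card_eq_fintype_card] at h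
    rw [LinearMap.trace_eq_matrix_trace k b, LinearMap.trace_eq_matrix_trace k b]
    exact h
  induction N with
  | zero => simp
  | succ N ih => rw [pow_succ, pow_mul, h1, ih]

/-- A sufficiently high `q ^ N`-th power of an element, `q = |k|`, is `p`-regular. -/
theorem exists_coprime_orderOf_pow_card_pow (p : ℕ) [hpp : Fact p.Prime] [CharP k p] [Finite Γ]
    (g : Γ) : ∃ N : ℕ, (orderOf (g ^ Nat.card k ^ N)).Coprime p := by
  have := Fintype.ofFinite k
  obtain ⟨c, -, hc⟩ := FiniteField.card k p
  have hpos := orderOf_pos g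
  refine ⟨(orderOf g).factorization p, ?_⟩
  refine Nat.Coprime.coprime_dvd_left ?_ (Nat.coprime_ordCompl hpp.out hpos.ne').symm
  rw [orderOf_dvd_iff_pow_eq_one, ← pow_mul, ← orderOf_dvd_iff_pow_eq_one]
  conv_lhs => rw [← Nat.ordProj_mul_ordCompl_eq_self (orderOf g) p]
  refine mul_dvd_mul ?_ dvd_rfl
  rw [Nat.card_eq_fintype_card, hc, ← pow_mul]
  exact pow_dvd_pow p (Nat.le_mul_of_pos_left _ c.pos)

/-- Over a finite field of characteristic `p`, a linear relation between the traces of pairwise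
inequivalent irreducible representations that holds on the `p`-regular elements is trivial. -/
theorem eq_zero_of_sum_trace_eq_zero (p : ℕ) [Fact p.Prime] [CharP k p] [Finite Γ]
    {ι : Type*} [Fintype ι] (V : ι → Type*) [∀ i, AddCommGroup (V i)] [∀ i, Module k (V i)]
    [∀ i, Module.Finite k (V i)] (ρ : ∀ i, Representation k Γ (V i))
    (hρ : ∀ i, (ρ i).IsIrreducible)
    (hne : ∀ i j, i ≠ j → ¬ ∃ e : V i ≃ₗ[k] V j, ∀ g v, e (ρ i g v) = ρ j g (e v))
    (c : ι → k)
    (hc : ∀ g : Γ, (orderOf g).Coprime p → ∑ i, c i * LinearMap.trace k (V i) (ρ i g) = 0)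
    (i : ι) : c i = 0 := by
  have hall : ∀ g : Γ, ∑ i, c i * LinearMap.trace k (V i) (ρ i g) = 0 := by
    intro g
    obtain ⟨N, hN⟩ := exists_coprime_orderOf_pow_card_pow (k := k) p g
    simpa only [map_pow, trace_pow_card_pow] using hc _ hN
  have halg : ∀ a : MonoidAlgebra k Γ,
      ∑ i, c i * LinearMap.trace k (V i) ((ρ i).asAlgebraHom a) = 0 := by
    intro a
    induction a using MonoidAlgebra.induction_linear with
    | zero => simp
    | add a b ha hb => simp only [map_add, mul_add, Finset.sum_add_distrib, ha, hb, add_zero]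
    | single g r =>
      simp only [Representation.asAlgebraHom_single, map_smul, smul_eq_mul, mul_left_comm _ r]
      rw [← Finset.mul_sum, hall, mul_zero]
  have : ∀ i, IsSimpleModule (MonoidAlgebra k Γ) (ρ i).asModule := fun i =>
    (Representation.irreducible_iff_isSimpleModule_asModule (ρ i)).1 (hρ i)
  have : ∀ i, Module.Finite k (ρ i).asModule := fun i =>
    Module.Finite.equiv (ρ i).asModuleEquiv.symm
  obtain ⟨a, ha, ha'⟩ := exists_trace_ne_zero_of_simple (k := k) (A := MonoidAlgebra k Γ)
    (fun i => (ρ i).asModule) (fun i j hij => ⟨fun e => hne i j hij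
      ⟨(ρ i).asModuleEquiv.symm ≪≫ₗ e.restrictScalars k ≪≫ₗ (ρ j).asModuleEquiv, fun g v => by
        rw [LinearEquiv.trans_apply, LinearEquiv.trans_apply,
          Representation.asModuleEquiv_symm_map_rho, LinearEquiv.restrictScalars_apply, map_smul,
          Representation.asModuleEquiv_map_smul, Representation.asAlgebraHom_of]
        rfl⟩⟩) i
  have htr : ∀ j, LinearMap.trace k (V j) ((ρ j).asAlgebraHom a) =
      LinearMap.trace k (ρ j).asModule (Algebra.lsmul k k (ρ j).asModule a) := by
    intro j
    rw [← LinearMap.trace_conj' _ (ρ j).asModuleEquiv]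
    rfl
  have h := halg a
  rw [Finset.sum_eq_single i] at h
  · rw [htr] at h
    exact (mul_eq_zero.1 h).resolve_right ha
  · intro j _ hj
    have : Algebra.lsmul k k (ρ j).asModule a = 0 := by
      ext v
      exact ha' j hj v
    rw [htr, this, map_zero, mul_zero]
  · simp

end GroupTraces

/-! ### Induced modules over the bismash product -/

section BismashModules

open scoped Classical

variable {Q : Type*} [Group Q] {F G : Subgroup Q} {hQ : F.IsComplement' G} {x : G}

theorem mem_stab_iff {a : F} : a ∈ stab hQ x ↔ actR hQ x a = x := Iff.rfl

theorem actR_inv_mul_of_mem_stab {s : F} (hs : s ∈ stab hQ x) (b : F) :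
    actR hQ x (b * s)⁻¹ = actR hQ x b⁻¹ := by
  rw [mul_inv_rev, actR_mul, mem_stab_iff.1 (inv_mem hs)]

theorem actR_inv_eq_iff_mem_stab (b c : F) :
    actR hQ x b⁻¹ = actR hQ x c⁻¹ ↔ c⁻¹ * b ∈ stab hQ x := by
  rw [mem_stab_iff, actR_mul]
  constructor
  · intro h
    rw [← h, ← actR_mul, inv_mul_cancel, actR_one]
  · intro h
    rw [← actR_actR_inv hQ (actR hQ x c⁻¹) b, h]

variable {W : Type*} [AddCommGroup W]

theorem PreInd.zero_apply (c : F) : (0 : PreInd hQ x W) c = 0 := rfl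

theorem PreInd.pure_apply (b : F) (w : W) (c : F) :
    PreInd.pure hQ x b w c = if c = b then w else 0 := by
  simp [PreInd.pure, Pi.single_apply]

variable [Fintype F] {E : Type*} [Field E] [Module E W]

theorem Bismash.algebraMap_apply (r : E) (y : G) (a : F) :
    (algebraMap E (Bismash E hQ) r) y a = if a = 1 then r else 0 := by
  rw [Algebra.algebraMap_eq_smul_one, Bismash.smul_apply, Bismash.one_apply, mul_ite, mul_one,
    mul_zero]

theorem Bismash.finset_sum_apply {α : Type*} (s : Finset α) (f : α → Bismash E hQ) (y : G)
    (c : F) : (∑ i ∈ s, f i) y c = ∑ i ∈ s, f i y c := by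
  induction s using Finset.induction_on with
  | empty => rfl
  | insert i s hi ih => rw [Finset.sum_insert hi, Finset.sum_insert hi, Bismash.add_apply, ih]

theorem Bismash.sum_basis_one [Fintype G] : ∑ y : G, Bismash.basis hQ y 1 = (1 : Bismash E hQ) := by
  refine Bismash.ext hQ fun z c => ?_
  rw [Bismash.finset_sum_apply, Bismash.one_apply]
  by_cases hc : c = 1 <;> simp [Bismash.basis, hc]

theorem Bismash.basis_one_mul (y : G) (h : Bismash E hQ) :
    Bismash.basis hQ y 1 * h = ∑ a : F, algebraMap E (Bismash E hQ) (h y a) * basis hQ y a := by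
  refine Bismash.ext hQ fun z c => ?_
  rw [Bismash.finset_sum_apply, Bismash.mul_apply, Finset.sum_eq_single 1, Finset.sum_eq_single c]
  · rw [← Algebra.smul_def, Bismash.smul_apply]
    by_cases hz : z = y <;> simp [Bismash.basis, hz, actR_one]
  · intro a _ ha
    rw [← Algebra.smul_def, Bismash.smul_apply]
    simp [Bismash.basis, ha.symm]
  · simp
  · intro a _ ha
    simp [Bismash.basis, ha]
  · simp

theorem Bismash.mul_basis (h : Bismash E hQ) (b : F) :
    h * Bismash.basis hQ (actR hQ x b⁻¹) b =
      ∑ c : F, algebraMap E (Bismash E hQ) (h (actR hQ x c⁻¹) (c * b⁻¹)) *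
        Bismash.basis hQ (actR hQ x c⁻¹) c := by
  refine Bismash.ext hQ fun z c => ?_
  rw [Bismash.finset_sum_apply, Bismash.mul_apply, Finset.sum_eq_single (c * b⁻¹),
    Finset.sum_eq_single c]
  · rw [← Algebra.smul_def, Bismash.smul_apply]
    have : actR hQ z (c * b⁻¹) = actR hQ x b⁻¹ ↔ z = actR hQ x c⁻¹ := by
      constructor
      · intro h
        rw [← actR_actR_inv hQ z (c * b⁻¹), h, ← actR_mul]
        simp
      · rintro rfl
        rw [← actR_mul]
        simp
    by_cases hz : z = actR hQ x c⁻¹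
    · have h' := this.2 hz
      subst hz
      simp [Bismash.basis, h']
    · simp [Bismash.basis, this, hz]
  · intro a _ ha
    rw [← Algebra.smul_def, Bismash.smul_apply]
    simp [Bismash.basis, ha.symm]
  · simp
  · intro a _ ha
    have : a⁻¹ * c ≠ b := by
      rintro rfl
      exact ha (by group)
    simp [Bismash.basis, this]
  · simp

theorem PreInd.algebraMap_smul (r : E) (f : PreInd hQ x W) (c : F) :
    (algebraMap E (Bismash E hQ) r • f) c = r • f c := by
  rw [PreInd.smul_apply, Finset.sum_eq_single 1]
  · simp [Bismash.algebraMap_apply]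
  · intro a _ ha
    simp [Bismash.algebraMap_apply, ha]
  · simp

theorem PreInd.finset_sum_apply {α : Type*} (s : Finset α) (f : α → PreInd hQ x W) (c : F) :
    (∑ i ∈ s, f i) c = ∑ i ∈ s, f i c := by
  induction s using Finset.induction_on with
  | empty => rfl
  | insert i s hi ih => rw [Finset.sum_insert hi, Finset.sum_insert hi, PreInd.add_apply, ih]

theorem PreInd.sum_pure (f : PreInd hQ x W) : ∑ b : F, PreInd.pure hQ x b (f b) = f := by
  refine PreInd.ext hQ x fun c => ?_
  rw [PreInd.finset_sum_apply, Finset.sum_eq_single c]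
  · simp [PreInd.pure_apply]
  · intro b _ hb
    simp [PreInd.pure_apply, hb.symm]
  · simp

/-- The `H_E`-linear endomorphism `f ↦ (c ↦ ∑ ρ(s) f(cs))` of `E F ⊗_E W`, the sum over
`s ∈ F_x`. Its kernel is spanned by the relations `bs ⊗ w = b ⊗ sw`, so that it identifies `Ŵ` with
a module of functions on `F`. -/
noncomputable def coindMap (ρ : Representation E (stab hQ x) W) :
    PreInd hQ x W →ₗ[Bismash E hQ] PreInd hQ x W where
  toFun f := fun c => ∑ s : stab hQ x, ρ s (f (c * s))
  map_add' f g := by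
    refine PreInd.ext hQ x fun c => ?_
    change _ = (∑ s : stab hQ x, ρ s (f (c * s))) + ∑ s : stab hQ x, ρ s (g (c * s))
    rw [← Finset.sum_add_distrib]
    exact Finset.sum_congr rfl fun s _ => map_add (ρ s) (f (c * s)) (g (c * s))
  map_smul' h f := by
    refine PreInd.ext hQ x fun c => ?_
    simp only [PreInd.smul_apply, RingHom.id_apply, map_sum, map_smul]
    rw [Finset.sum_comm]
    refine Finset.sum_congr rfl fun a _ => ?_
    rw [Finset.smul_sum]
    refine Finset.sum_congr rfl fun s _ => ?_
    rw [actR_inv_mul_of_mem_stab s.2, mul_assoc]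

theorem coindMap_apply (ρ : Representation E (stab hQ x) W) (f : PreInd hQ x W) (c : F) :
    coindMap ρ f c = ∑ s : stab hQ x, ρ s (f (c * s)) := rfl

theorem coindMap_apply_mul (ρ : Representation E (stab hQ x) W) (f : PreInd hQ x W) (c : F)
    (s : stab hQ x) : coindMap ρ f (c * s) = ρ s⁻¹ (coindMap ρ f c) := by
  rw [coindMap_apply, coindMap_apply, map_sum]
  refine Fintype.sum_equiv (Equiv.mulLeft s) _ _ fun u => ?_
  rw [Equiv.coe_mulLeft, ← Module.End.mul_apply, ← map_mul, inv_mul_cancel_left, Subgroup.coe_mul,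
    mul_assoc]

theorem coindMap_pure (ρ : Representation E (stab hQ x) W) (b : F) (s : stab hQ x) (w : W) :
    coindMap ρ (PreInd.pure hQ x (b * s) w) = coindMap ρ (PreInd.pure hQ x b (ρ s w)) := by
  refine PreInd.ext hQ x fun c => ?_
  rw [coindMap_apply, coindMap_apply]
  refine (Fintype.sum_equiv (Equiv.mulRight s) _ _ fun u => ?_).symm
  rw [Equiv.coe_mulRight, PreInd.pure_apply, PreInd.pure_apply, map_mul, Subgroup.coe_mul,
    ← mul_assoc]
  by_cases h : c * u = b <;> simp [h]

theorem coindMap_pure_one_apply_one (ρ : Representation E (stab hQ x) W) (w : W) :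
    coindMap ρ (PreInd.pure hQ x 1 w) 1 = w := by
  rw [coindMap_apply, Finset.sum_eq_single 1]
  · simp [PreInd.pure_apply]
  · intro s _ hs
    have : (s : F) ≠ 1 := by simpa using hs
    simp [PreInd.pure_apply, this]
  · simp

theorem pure_sub_pure_mem_indRelations (ρ : Representation E (stab hQ x) W) (b : F)
    (s : stab hQ x) (w : W) :
    PreInd.pure hQ x (b * s) w - PreInd.pure hQ x b (ρ s w) ∈ indRelations hQ ρ :=
  Submodule.subset_span ⟨b, s, w, rfl⟩

theorem PreInd.pure_sum {α : Type*} (s : Finset α) (b : F) (w : α → W) :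
    PreInd.pure hQ x b (∑ i ∈ s, w i) = ∑ i ∈ s, PreInd.pure hQ x b (w i) := by
  refine PreInd.ext hQ x fun c => ?_
  rw [PreInd.finset_sum_apply]
  by_cases hc : c = b <;> simp [PreInd.pure_apply, hc]

/-- Modulo the relations, `f = ∑ b ⊗ f(b)` can be rewritten, with `b = ts` for representatives `t`
of the cosets `tF_x`, as the sum over `t` of `t ⊗ g(t)`, where `g` is the image of `f` under
`coindMap`. -/
theorem ker_coindMap (ρ : Representation E (stab hQ x) W) :
    LinearMap.ker (coindMap ρ) = indRelations hQ ρ := by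
  apply le_antisymm
  · intro f hf
    rw [LinearMap.mem_ker] at hf
    obtain ⟨S, hS, -⟩ := (stab hQ x).exists_isComplement_left 1
    let e : S × stab hQ x ≃ F := Equiv.ofBijective _ hS
    have he : ∀ u, e u = u.1 * u.2 := fun u => rfl
    have h1 : f = ∑ t : S, ∑ s : stab hQ x, (PreInd.pure hQ x ((t : F) * s) (f (t * s)) -
        PreInd.pure hQ x t (ρ s (f (t * s)))) := by
      have h2 : ∀ t : S, ∑ s : stab hQ x, PreInd.pure hQ x (t : F) (ρ s (f (t * s))) = 0 := by
        intro t
        rw [← PreInd.pure_sum, ← coindMap_apply, hf]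
        refine PreInd.ext hQ x fun c => ?_
        simp [PreInd.pure_apply, PreInd.zero_apply]
      simp only [Finset.sum_sub_distrib, h2, sub_zero]
      rw [← Fintype.sum_prod_type' fun (t : S) (s : stab hQ x) =>
        PreInd.pure hQ x ((t : F) * s) (f (t * s))]
      conv_lhs => rw [← PreInd.sum_pure f]
      exact (Fintype.sum_equiv e _ _ fun u => by rw [he]).symm
    rw [h1]
    exact Submodule.sum_mem _ fun t _ => Submodule.sum_mem _ fun s _ =>
      pure_sub_pure_mem_indRelations ρ t s _
  · refine Submodule.span_le.2 ?_
    rintro _ ⟨b, s, w, rfl⟩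
    rw [SetLike.mem_coe, LinearMap.mem_ker, map_sub, coindMap_pure, sub_self]

/-- The embedding of `Ŵ` into `E F ⊗_E W` induced by `coindMap`. -/
noncomputable def indModuleEmbedding (ρ : Representation E (stab hQ x) W) :
    IndModule hQ ρ →ₗ[Bismash E hQ] PreInd hQ x W :=
  (indRelations hQ ρ).liftQ (coindMap ρ) (ker_coindMap ρ).ge

theorem indModuleEmbedding_mk (ρ : Representation E (stab hQ x) W) (f : PreInd hQ x W) :
    indModuleEmbedding ρ (Submodule.Quotient.mk f) = coindMap ρ f := rfl

theorem indModuleEmbedding_injective (ρ : Representation E (stab hQ x) W) :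
    Function.Injective (indModuleEmbedding ρ) := by
  rw [← LinearMap.ker_eq_bot]
  exact Submodule.ker_liftQ_eq_bot _ _ _ (ker_coindMap ρ).le

variable {M : Type*} [AddCommGroup M] [Module (Bismash E hQ) M]

/-- `τ` identifies the representation `ρ` of `F_x` with a subspace of `p_x M`, on which `s ∈ F_x`
acts as `p_x # s`. -/
structure IsWeightEmbedding (ρ : Representation E (stab hQ x) W) (τ : W →+ M) : Prop where
  injective : Function.Injective τ
  map_smul : ∀ (r : E) (w : W), τ (r • w) = algebraMap E (Bismash E hQ) r • τ w
  map_rho : ∀ (s : stab hQ x) (w : W),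
    τ (ρ s w) = (Bismash.basis hQ x (s : F) : Bismash E hQ) • τ w

theorem IsWeightEmbedding.basis_one_smul {ρ : Representation E (stab hQ x) W} {τ : W →+ M}
    (h : IsWeightEmbedding ρ τ) (w : W) :
    (Bismash.basis hQ x 1 : Bismash E hQ) • τ w = τ w := by
  have := h.map_rho 1 w
  rw [map_one, Module.End.one_apply] at this
  exact this.symm

/-- The `H_E`-linear extension `b ⊗ w ↦ (p_{x ◁ b⁻¹} # b) τ(w)` of a weight embedding. -/
noncomputable def IsWeightEmbedding.extend {ρ : Representation E (stab hQ x) W} {τ : W →+ M}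
    (hτ : IsWeightEmbedding ρ τ) : PreInd hQ x W →ₗ[Bismash E hQ] M where
  toFun f := ∑ b : F, (Bismash.basis hQ (actR hQ x b⁻¹) b : Bismash E hQ) • τ (f b)
  map_add' f g := by
    simp [PreInd.add_apply, Finset.sum_add_distrib]
  map_smul' h f := by
    have e : ∀ b : F, h • (Bismash.basis hQ (actR hQ x b⁻¹) b : Bismash E hQ) • τ (f b) =
        ∑ c : F, (algebraMap E (Bismash E hQ) (h (actR hQ x c⁻¹) (c * b⁻¹)) *
          Bismash.basis hQ (actR hQ x c⁻¹) c) • τ (f b) := fun b => by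
      rw [smul_smul, Bismash.mul_basis, Finset.sum_smul]
    rw [RingHom.id_apply, Finset.smul_sum, Finset.sum_congr rfl fun b _ => e b, Finset.sum_comm]
    refine Finset.sum_congr rfl fun c _ => ?_
    rw [PreInd.smul_apply, map_sum, Finset.smul_sum]
    refine Fintype.sum_equiv ((Equiv.inv F).trans (Equiv.mulRight c)) _ _ fun a => ?_
    simp only [Equiv.trans_apply, Equiv.inv_apply, Equiv.coe_mulRight, mul_inv_rev, inv_inv,
      mul_inv_cancel_left]
    rw [hτ.map_smul, smul_smul, Algebra.commutes]

theorem IsWeightEmbedding.extend_apply {ρ : Representation E (stab hQ x) W} {τ : W →+ M}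
    (hτ : IsWeightEmbedding ρ τ) (f : PreInd hQ x W) : hτ.extend f =
      ∑ b : F, (Bismash.basis hQ (actR hQ x b⁻¹) b : Bismash E hQ) • τ (f b) := rfl

theorem IsWeightEmbedding.extend_pure {ρ : Representation E (stab hQ x) W} {τ : W →+ M}
    (hτ : IsWeightEmbedding ρ τ) (b : F) (w : W) : hτ.extend (PreInd.pure hQ x b w) =
      (Bismash.basis hQ (actR hQ x b⁻¹) b : Bismash E hQ) • τ w := by
  rw [hτ.extend_apply, Finset.sum_eq_single b]
  · simp [PreInd.pure_apply]
  · intro c _ hc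
    simp [PreInd.pure_apply, hc]
  · simp

theorem IsWeightEmbedding.ker_extend {ρ : Representation E (stab hQ x) W} {τ : W →+ M}
    (hτ : IsWeightEmbedding ρ τ) : LinearMap.ker hτ.extend = indRelations hQ ρ := by
  apply le_antisymm
  · intro f hf
    rw [LinearMap.mem_ker, hτ.extend_apply] at hf
    rw [← ker_coindMap, LinearMap.mem_ker]
    refine PreInd.ext hQ x fun c => hτ.injective ?_
    -- `p_x # c⁻¹` recovers the value at `c` of the image of `f` under `coindMap`.
    have h := congrArg (fun m => (Bismash.basis hQ x c⁻¹ : Bismash E hQ) • m) hf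
    simp only [Finset.smul_sum, smul_smul, smul_zero, Bismash.basis_mul_basis,
      actR_inv_eq_iff_mem_stab] at h
    rw [PreInd.zero_apply, map_zero, ← h, coindMap_apply, map_sum]
    rw [← Fintype.sum_equiv (Equiv.mulLeft c)
      (fun b => (if b ∈ stab hQ x then (Bismash.basis hQ x b : Bismash E hQ) else 0) •
        τ (f (c * b))) _ fun b => by simp]
    rw [← Finset.sum_subset (Finset.subset_univ (Finset.univ.filter (· ∈ stab hQ x)))]
    · rw [Finset.sum_subtype (p := (· ∈ stab hQ x)) _ (by simp)]
      refine Finset.sum_congr rfl fun s _ => ?_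
      rw [if_pos s.2, hτ.map_rho]
    · intro b _ hb
      rw [if_neg (by simpa using hb), zero_smul]
  · refine Submodule.span_le.2 ?_
    rintro _ ⟨b, s, w, rfl⟩
    rw [SetLike.mem_coe, LinearMap.mem_ker, map_sub, hτ.extend_pure, hτ.extend_pure, hτ.map_rho,
      smul_smul, Bismash.basis_mul_basis, if_pos, actR_inv_mul_of_mem_stab s.2, sub_self]
    rw [← actR_mul, inv_mul_cancel, actR_one]

theorem IsWeightEmbedding.nonempty_equiv [Nontrivial W] [IsSimpleModule (Bismash E hQ) M]
    {ρ : Representation E (stab hQ x) W} {τ : W →+ M} (hτ : IsWeightEmbedding ρ τ) :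
    Nonempty (IndModule hQ ρ ≃ₗ[Bismash E hQ] M) := by
  refine ⟨LinearEquiv.ofBijective ((indRelations hQ ρ).liftQ hτ.extend hτ.ker_extend.ge) ⟨?_, ?_⟩⟩
  · rw [← LinearMap.ker_eq_bot]
    exact Submodule.ker_liftQ_eq_bot _ _ _ hτ.ker_extend.le
  · refine LinearMap.surjective_of_ne_zero fun h0 => ?_
    obtain ⟨w, hw⟩ := exists_ne (0 : W)
    have h := LinearMap.congr_fun h0 (Submodule.Quotient.mk (PreInd.pure hQ x 1 w))
    rw [Submodule.liftQ_apply, hτ.extend_pure, inv_one, actR_one, hτ.basis_one_smul,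
      LinearMap.zero_apply] at h
    exact hw ((map_eq_zero_iff τ hτ.injective).1 h)

theorem IsWeightEmbedding.isIrreducible [Nontrivial W] [IsSimpleModule (Bismash E hQ) M]
    {ρ : Representation E (stab hQ x) W} {τ : W →+ M} (hτ : IsWeightEmbedding ρ τ) :
    ρ.IsIrreducible := by
  have : Nontrivial (Subrepresentation ρ) := by
    refine ⟨⊥, ⊤, fun h => ?_⟩
    obtain ⟨w, hw⟩ := exists_ne (0 : W)
    have : w ∈ (⊤ : Subrepresentation ρ) := trivial
    rw [← h] at this
    exact hw this
  refine ⟨fun U => or_iff_not_imp_left.2 fun hU => ?_⟩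
  obtain ⟨u, huU, hu⟩ : ∃ u ∈ U, u ≠ 0 := by
    by_contra! h
    refine hU (le_antisymm (fun u hu => ?_) bot_le)
    exact h u hu
  refine le_antisymm le_top fun w _ => ?_
  obtain ⟨h, hh⟩ := IsSimpleModule.toSpanSingleton_surjective (Bismash E hQ)
    (m := τ u) (fun h0 => hu ((map_eq_zero_iff τ hτ.injective).1 h0)) (τ w)
  -- `τ(w) = p_x h p_x τ(u)`, and `p_x h p_x` is a combination of the `p_x # s`, `s ∈ F_x`.
  have hw : w = ∑ s : stab hQ x, h x s • ρ s u := by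
    apply hτ.injective
    rw [map_sum, ← hτ.basis_one_smul w, ← hh, LinearMap.toSpanSingleton_apply,
      ← hτ.basis_one_smul u, smul_smul, smul_smul, Bismash.basis_one_mul,
      Finset.sum_mul, Finset.sum_smul]
    rw [← Finset.sum_subset (Finset.subset_univ (Finset.univ.filter (· ∈ stab hQ x)))]
    · rw [Finset.sum_subtype (p := (· ∈ stab hQ x)) _ (by simp)]
      refine Finset.sum_congr rfl fun s _ => ?_
      rw [hτ.map_smul, hτ.map_rho, mul_assoc, Bismash.basis_mul_basis,
        if_pos (mem_stab_iff.1 s.2).symm, mul_one, mul_smul]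
    · intro b _ hb
      rw [mul_assoc, Bismash.basis_mul_basis, if_neg, mul_zero, zero_smul]
      intro hb'
      exact hb (by simpa using mem_stab_iff.2 hb'.symm)
  rw [hw]
  exact U.toSubmodule.sum_mem fun s _ =>
    U.toSubmodule.smul_mem _ (U.apply_mem_toSubmodule s huU)

end BismashModules

/-! ### Simple modules over the bismash product -/

section SimpleModules

open scoped Classical

variable {Q : Type*} [Group Q] {F G : Subgroup Q} [Fintype F] {E : Type*} [Field E]
  {hQ : F.IsComplement' G}

theorem Bismash.finite_of_isSimpleModule [Finite E] [Finite G] (M : Type*) [AddCommGroup M]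
    [Module (Bismash E hQ) M] [IsSimpleModule (Bismash E hQ) M] : Finite M := by
  have : Finite (Bismash E hQ) := inferInstanceAs (Finite (G → F → E))
  have := IsSimpleModule.nontrivial (Bismash E hQ) M
  obtain ⟨m, hm⟩ := exists_ne (0 : M)
  exact Finite.of_surjective _ (IsSimpleModule.toSpanSingleton_surjective (Bismash E hQ) hm)

theorem exists_basis_one_smul_ne_zero [Fintype G] {T : Set G} (hT : IsOrbitReps hQ T)
    {M : Type*} [AddCommGroup M] [Module (Bismash E hQ) M] {m : M} (hm : m ≠ 0) :
    ∃ x ∈ T, ∃ v : M, v ≠ 0 ∧ (Bismash.basis hQ x 1 : Bismash E hQ) • v = v := by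
  obtain ⟨y, hy⟩ : ∃ y : G, (Bismash.basis hQ y 1 : Bismash E hQ) • m ≠ 0 := by
    by_contra! h
    apply hm
    rw [← one_smul (Bismash E hQ) m, ← Bismash.sum_basis_one, Finset.sum_smul]
    exact Finset.sum_eq_zero fun y _ => h y
  obtain ⟨x, ⟨hx, a, rfl⟩, -⟩ := hT y
  refine ⟨_, hx, (Bismash.basis hQ (actR hQ y a) a⁻¹ : Bismash E hQ) • m, fun h0 => hy ?_, ?_⟩
  · have := congrArg (fun v => (Bismash.basis hQ y a : Bismash E hQ) • v) h0
    simpa [smul_smul, Bismash.basis_mul_basis] using this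
  · rw [smul_smul, Bismash.basis_mul_basis, actR_one, if_pos rfl, one_mul]

/-- A simple `H_E`-module `M` has `p_x M ≠ 0` for some orbit representative `x`, and `p_x M` is a
representation of `F_x`. -/
theorem exists_isWeightEmbedding [Finite E] [Fintype G] {T : Set G} (hT : IsOrbitReps hQ T)
    (M : Type*) [AddCommGroup M] [Module (Bismash E hQ) M] [IsSimpleModule (Bismash E hQ) M] :
    ∃ x ∈ T, ∃ (n : ℕ) (ρ : Representation E (stab hQ x) (Fin n → E)) (τ : (Fin n → E) →+ M),
      Nontrivial (Fin n → E) ∧ IsWeightEmbedding ρ τ := by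
  have := Bismash.finite_of_isSimpleModule (E := E) (hQ := hQ) M
  have := IsSimpleModule.nontrivial (Bismash E hQ) M
  obtain ⟨m, hm⟩ := exists_ne (0 : M)
  obtain ⟨x, hx, v, hv, hxv⟩ := exists_basis_one_smul_ne_zero (E := E) hT hm
  let _ : Module E M := Module.compHom M (algebraMap E (Bismash E hQ))
  have hsmul : ∀ (r : E) (m : M), r • m = algebraMap E (Bismash E hQ) r • m := fun _ _ => rfl
  have hcomm : ∀ (h : Bismash E hQ) (r : E) (m : M), h • r • m = r • h • m := fun h r m => by
    rw [hsmul, hsmul, smul_smul, smul_smul, Algebra.commutes]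
  let V : Submodule E M :=
    { carrier := {m | (Bismash.basis hQ x 1 : Bismash E hQ) • m = m}
      add_mem' := fun {a b} ha hb => by
        rw [Set.mem_ofPred_eq] at *
        rw [smul_add, ha, hb]
      zero_mem' := smul_zero _
      smul_mem' := fun r m hm => by
        rw [Set.mem_ofPred_eq] at *
        rw [hcomm, hm] }
  have hmem : ∀ m, m ∈ V ↔ (Bismash.basis hQ x 1 : Bismash E hQ) • m = m := fun _ => Iff.rfl
  let ρV : Representation E (stab hQ x) V :=
    { toFun := fun s =>
        { toFun := fun v => ⟨(Bismash.basis hQ x (s : F) : Bismash E hQ) • (v : M), by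
            rw [hmem, smul_smul, Bismash.basis_mul_basis, actR_one, if_pos rfl, one_mul]⟩
          map_add' := fun v w => Subtype.ext (smul_add _ _ _)
          map_smul' := fun r v => Subtype.ext (hcomm _ r v) }
      map_one' := by
        ext v
        exact (hmem v).1 v.2
      map_mul' := fun s t => by
        ext v
        have h : (Bismash.basis hQ x (s : F) : Bismash E hQ) •
            (Bismash.basis hQ x (t : F) : Bismash E hQ) • (v : M) =
              (Bismash.basis hQ x ((s : F) * t) : Bismash E hQ) • (v : M) := by
          rw [smul_smul, Bismash.basis_mul_basis, if_pos (mem_stab_iff.1 s.2).symm]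
        exact h.symm }
  have : Nontrivial V := ⟨⟨⟨v, hxv⟩, 0, fun h => hv (congrArg Subtype.val h)⟩⟩
  have : Module.Finite E V := Module.Finite.of_finite
  let e : V ≃ₗ[E] (Fin (Module.finrank E V) → E) := (Module.finBasis E V).equivFun
  refine ⟨x, hx, _, (e.conjRingEquiv : Module.End E V →* _).comp ρV,
    V.subtype.toAddMonoidHom.comp e.symm.toLinearMap.toAddMonoidHom, e.symm.toEquiv.nontrivial,
    ⟨?_, fun r w => ?_, fun s w => ?_⟩⟩
  · exact Subtype.val_injective.comp e.symm.injective
  · change ((e.symm (r • w) : V) : M) = r • ((e.symm w : V) : M)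
    rw [map_smul, Submodule.coe_smul]
  · change ((e.symm (e (ρV s (e.symm w))) : V) : M) = _
    rw [e.symm_apply_apply]
    rfl

theorem PreInd.basis_smul_apply {x : G} {W : Type*} [AddCommGroup W] [Module E W] (y : G) (a : F)
    (f : PreInd hQ x W) (c : F) : ((Bismash.basis hQ y a : Bismash E hQ) • f) c =
      if actR hQ x c⁻¹ = y then f (a⁻¹ * c) else 0 := by
  rw [PreInd.smul_apply, Finset.sum_eq_single a]
  · by_cases h : actR hQ x c⁻¹ = y <;> simp [Bismash.basis, h]
  · intro b _ hb
    simp [Bismash.basis, hb]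
  · simp

section Homs

variable {x x' : G} {W W' : Type*} [AddCommGroup W] [Module E W] [AddCommGroup W'] [Module E W']
  {ρ : Representation E (stab hQ x) W} {ρ' : Representation E (stab hQ x') W'}

/-- A homomorphism `Ŵ → Ŵ'`, restricted to `1 ⊗ W` and read in `E F ⊗_E W'`. -/
noncomputable def indHomFunction (e : IndModule hQ ρ →ₗ[Bismash E hQ] IndModule hQ ρ') (w : W) :
    PreInd hQ x' W' :=
  indModuleEmbedding ρ' (e (Submodule.Quotient.mk (PreInd.pure hQ x 1 w)))

theorem indHomFunction_mem_range (e : IndModule hQ ρ →ₗ[Bismash E hQ] IndModule hQ ρ') (w : W) :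
    ∃ f, indHomFunction e w = coindMap ρ' f := by
  obtain ⟨f, hf⟩ := Submodule.Quotient.mk_surjective _
    (e (Submodule.Quotient.mk (PreInd.pure hQ x 1 w)))
  exact ⟨f, by rw [indHomFunction, ← hf, indModuleEmbedding_mk]⟩

theorem indHomFunction_injective (e : IndModule hQ ρ ≃ₗ[Bismash E hQ] IndModule hQ ρ') {w : W}
    (h : indHomFunction (e : IndModule hQ ρ →ₗ[Bismash E hQ] IndModule hQ ρ') w = 0) : w = 0 := by
  have h1 := (map_eq_zero_iff _ (indModuleEmbedding_injective ρ')).1 h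
  have h2 : (Submodule.Quotient.mk (PreInd.pure hQ x 1 w) : IndModule hQ ρ) = 0 :=
    (map_eq_zero_iff e e.injective).1 h1
  rw [Submodule.Quotient.mk_eq_zero, ← ker_coindMap, LinearMap.mem_ker] at h2
  rw [← coindMap_pure_one_apply_one ρ w, h2, PreInd.zero_apply]

theorem basis_smul_indHomFunction (e : IndModule hQ ρ →ₗ[Bismash E hQ] IndModule hQ ρ')
    (s : stab hQ x) (w : W) : (Bismash.basis hQ x (s : F) : Bismash E hQ) • indHomFunction e w =
      indHomFunction e (ρ s w) := by
  rw [indHomFunction, indHomFunction, ← map_smul, ← map_smul, ← Submodule.Quotient.mk_smul]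
  congr 2
  rw [PreInd.basis_smul_pure, mul_one, if_pos (mem_stab_iff.1 s.2), Submodule.Quotient.eq]
  have := pure_sub_pure_mem_indRelations ρ 1 s w
  rwa [one_mul] at this

theorem indHomFunction_apply_eq_zero (e : IndModule hQ ρ →ₗ[Bismash E hQ] IndModule hQ ρ')
    (w : W) {c : F} (hc : actR hQ x' c⁻¹ ≠ x) : indHomFunction e w c = 0 := by
  have h := basis_smul_indHomFunction e 1 w
  rw [map_one, Module.End.one_apply] at h
  rw [← h, PreInd.basis_smul_apply, if_neg hc]

theorem indHomFunction_add (e : IndModule hQ ρ →ₗ[Bismash E hQ] IndModule hQ ρ') (w v : W) :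
    indHomFunction e (w + v) = indHomFunction e w + indHomFunction e v := by
  have : PreInd.pure hQ x 1 (w + v) = PreInd.pure hQ x 1 w + PreInd.pure hQ x 1 v := by
    refine PreInd.ext hQ x fun c => ?_
    rw [PreInd.add_apply]
    by_cases hc : c = 1 <;> simp [PreInd.pure_apply, hc]
  rw [indHomFunction, indHomFunction, indHomFunction, this, Submodule.Quotient.mk_add, map_add,
    map_add]

theorem indHomFunction_smul (e : IndModule hQ ρ →ₗ[Bismash E hQ] IndModule hQ ρ') (r : E)
    (w : W) : indHomFunction e (r • w) = algebraMap E (Bismash E hQ) r • indHomFunction e w := by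
  have : PreInd.pure hQ x 1 (r • w) = algebraMap E (Bismash E hQ) r • PreInd.pure hQ x 1 w := by
    refine PreInd.ext hQ x fun c => ?_
    rw [PreInd.algebraMap_smul]
    by_cases hc : c = 1 <;> simp [PreInd.pure_apply, hc]
  rw [indHomFunction, indHomFunction, this, Submodule.Quotient.mk_smul, map_smul, map_smul]

theorem eq_of_indModule_equiv [Nontrivial W] {T : Set G} (hT : IsOrbitReps hQ T) (hx : x ∈ T)
    (hx' : x' ∈ T) (e : IndModule hQ ρ ≃ₗ[Bismash E hQ] IndModule hQ ρ') : x = x' := by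
  by_contra hne
  obtain ⟨w, hw⟩ := exists_ne (0 : W)
  refine hw (indHomFunction_injective e (PreInd.ext hQ x' fun c => ?_))
  rw [PreInd.zero_apply]
  refine indHomFunction_apply_eq_zero _ w fun h => hne ?_
  exact (hT x').unique ⟨hx, c⁻¹, h⟩ ⟨hx', 1, actR_one hQ x'⟩

end Homs

/-- `Ŵ` determines `W`: an isomorphism `Ŵ ≅ Ŵ'` restricts to the subspaces cut out by `p_x`. -/
theorem exists_equiv_of_indModule_equiv {x : G} {W W' : Type*} [AddCommGroup W] [Module E W]
    [AddCommGroup W'] [Module E W'] {ρ : Representation E (stab hQ x) W}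
    {ρ' : Representation E (stab hQ x) W'} [ρ.IsIrreducible] [ρ'.IsIrreducible] [Nontrivial W]
    (e : IndModule hQ ρ ≃ₗ[Bismash E hQ] IndModule hQ ρ') :
    ∃ l : W ≃ₗ[E] W', ∀ s w, l (ρ s w) = ρ' s (l w) := by
  let e' : IndModule hQ ρ →ₗ[Bismash E hQ] IndModule hQ ρ' := e
  have hval : ∀ (s : stab hQ x) w, indHomFunction e' w s = ρ' s⁻¹ (indHomFunction e' w 1) := by
    intro s w
    obtain ⟨f, hf⟩ := indHomFunction_mem_range e' w
    have := coindMap_apply_mul ρ' f 1 s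
    rwa [one_mul, ← hf] at this
  let l : W →ₗ[E] W' :=
    { toFun := fun w => indHomFunction e' w 1
      map_add' := fun w v => by rw [indHomFunction_add, PreInd.add_apply]
      map_smul' := fun r w => by
        rw [indHomFunction_smul, PreInd.algebraMap_smul, RingHom.id_apply] }
  have hl : ∀ s w, l (ρ s w) = ρ' s (l w) := by
    intro s w
    change indHomFunction e' (ρ s w) 1 = ρ' s (indHomFunction e' w 1)
    rw [← basis_smul_indHomFunction, PreInd.basis_smul_apply, inv_one, actR_one, if_pos rfl,
      mul_one, ← Subgroup.coe_inv, hval, inv_inv]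
  let L : ρ.IntertwiningMap ρ' := l.intertwiningMap_of_isIntertwiningMap ρ ρ' hl
  rcases Representation.IsIrreducible.bijective_or_eq_zero L with hb | h0
  · exact ⟨LinearEquiv.ofBijective l hb, hl⟩
  · exfalso
    obtain ⟨w, hw⟩ := exists_ne (0 : W)
    refine hw (indHomFunction_injective e (PreInd.ext hQ x fun c => ?_))
    rw [PreInd.zero_apply]
    by_cases hc : actR hQ x c⁻¹ = x
    · have hc' : c ∈ stab hQ x := inv_mem_iff.1 (mem_stab_iff.2 hc)
      have h1 : indHomFunction e' w 1 = 0 := DFunLike.congr_fun h0 w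
      have := hval ⟨c, hc'⟩ w
      rwa [h1, map_zero] at this
    · exact indHomFunction_apply_eq_zero e' w hc

end SimpleModules

/-! ### Brauer characters of the bismash product -/

section BismashBrauerCharacters

variable {Q : Type*} [Group Q] {F G : Subgroup Q} {hQ : F.IsComplement' G}
  {R : Type*} {K : Type*} [CommRing R] [IsLocalRing R] [Field K] [Algebra R K]

theorem groupBrauerCharacter_congr (p : ℕ) {Γ : Type*} [Group Γ] {W W' : Type*} [AddCommGroup W]
    [Module (IsLocalRing.ResidueField R) W] [Module.Finite (IsLocalRing.ResidueField R) W]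
    [AddCommGroup W'] [Module (IsLocalRing.ResidueField R) W']
    [Module.Finite (IsLocalRing.ResidueField R) W']
    {ρ : Representation (IsLocalRing.ResidueField R) Γ W}
    {ρ' : Representation (IsLocalRing.ResidueField R) Γ W'}
    (l : W ≃ₗ[IsLocalRing.ResidueField R] W') (hl : ∀ s w, l (ρ s w) = ρ' s (l w)) :
    groupBrauerCharacter K p ρ = groupBrauerCharacter K p ρ' := by
  funext g
  have : ρ' g.1 = l.conj (ρ g.1) := by
    ext w
    rw [LinearEquiv.conj_apply_apply, hl, LinearEquiv.apply_symm_apply]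
  rw [groupBrauerCharacter, groupBrauerCharacter, this, LinearEquiv.charpoly_conj]

theorem bismashBrauerCharacter_eq_of_indModule_equiv [Fintype F] {p : ℕ} {T : Set G}
    (hT : IsOrbitReps hQ T) (S : G → Finset F) {x y : G} (hx : x ∈ T) (hy : y ∈ T)
    {W W' : Type*} [AddCommGroup W] [Module (IsLocalRing.ResidueField R) W]
    [Module.Finite (IsLocalRing.ResidueField R) W] [Nontrivial W] [AddCommGroup W']
    [Module (IsLocalRing.ResidueField R) W'] [Module.Finite (IsLocalRing.ResidueField R) W']
    {ρ : Representation (IsLocalRing.ResidueField R) (stab hQ x) W}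
    {ρ' : Representation (IsLocalRing.ResidueField R) (stab hQ y) W'}
    [ρ.IsIrreducible] [ρ'.IsIrreducible]
    (e : IndModule hQ ρ ≃ₗ[Bismash (IsLocalRing.ResidueField R) hQ] IndModule hQ ρ') :
    bismashBrauerCharacter K p hQ (S x) ρ = bismashBrauerCharacter K p hQ (S y) ρ' := by
  obtain rfl := eq_of_indModule_equiv hT hx hy e
  obtain ⟨l, hl⟩ := exists_equiv_of_indModule_equiv e
  funext w
  unfold bismashBrauerCharacter
  rw [groupBrauerCharacter_congr p l hl]

/-- For orbit representatives `x`, `y`, the value of the Brauer character of `Ŵ` at `p_y # a` is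
that of `W` at a conjugate of `a` if `y = x`, and zero otherwise: the only `t` that contributes is
the representative of the coset `F_x`. -/
theorem exists_residue_eq_bismashBrauerCharacter [IsFractionRing R K]
    [IsAdicComplete (IsLocalRing.maximalIdeal R) R] {p : ℕ} [Fact p.Prime]
    [CharP (IsLocalRing.ResidueField R) p] [Finite F] {T : Set G} (hT : IsOrbitReps hQ T)
    {x y : G} (hx : x ∈ T) (hy : y ∈ T) {S : Finset F}
    (hS : Subgroup.IsComplement (S : Set F) (stab hQ x : Set F))
    {W : Type*} [AddCommGroup W] [Module (IsLocalRing.ResidueField R) W]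
    [Module.Finite (IsLocalRing.ResidueField R) W]
    (ρ : Representation (IsLocalRing.ResidueField R) (stab hQ x) W) (a : F) (ha : a ∈ stab hQ y)
    (hreg : IsOfFinOrder a ∧ (orderOf a).Coprime p) :
    ∃ r : R, algebraMap R K r = bismashBrauerCharacter K p hQ S ρ ⟨(y, a), ha, hreg⟩ ∧
      IsLocalRing.residue R r = open Classical in
        if h : x = y then LinearMap.trace _ W (ρ ⟨a, h ▸ ha⟩) else 0 := by
  classical
  by_cases h : x = y
  · subst h
    obtain ⟨⟨⟨t, ht⟩, ⟨s, hs⟩⟩, hts⟩ := hS.2 1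
    change t * s = 1 at hts
    have htx : t ∈ stab hQ x := by
      rw [eq_inv_of_mul_eq_one_left hts]
      exact inv_mem hs
    have hta : t⁻¹ * a * t ∈ stab hQ x := mul_mem (mul_mem (inv_mem htx) ha) htx
    obtain ⟨r, hr, hres⟩ := exists_residue_eq_trace_groupBrauerCharacter K ρ
      (⟨⟨t⁻¹ * a * t, hta⟩, pRegular_conj hta hreg⟩ : PRegular p (stab hQ x))
    refine ⟨r, ?_, ?_⟩
    · rw [hr]
      unfold bismashBrauerCharacter
      rw [Finset.sum_eq_single t]
      · rw [dif_pos hta, if_pos (mem_stab_iff.1 htx)]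
      · intro u hu hut
        have : actR hQ x u ≠ x := by
          intro hux
          have h1 := @hS.1 (⟨u, hu⟩, ⟨u⁻¹, inv_mem (mem_stab_iff.2 hux)⟩) (⟨t, ht⟩, ⟨s, hs⟩)
            (by change u * u⁻¹ = t * s; rw [hts, mul_inv_cancel])
          exact hut (congrArg (fun z => ((z.1 : S) : F)) h1)
        simp only [if_neg this, dite_eq_ite, ite_self]
      · exact fun h => (h ht).elim
    · have e : (⟨t⁻¹ * a * t, hta⟩ : stab hQ x) = ⟨t, htx⟩⁻¹ * (⟨a, ha⟩ * ⟨t, htx⟩) :=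
        Subtype.ext (mul_assoc _ _ _)
      have e' : (⟨a, ha⟩ : stab hQ x) = (⟨a, ha⟩ * ⟨t, htx⟩) * ⟨t, htx⟩⁻¹ := by group
      rw [dif_pos rfl, hres]
      change LinearMap.trace _ W (ρ ⟨t⁻¹ * a * t, hta⟩) = _
      rw [e, map_mul, LinearMap.trace_mul_comm, ← map_mul, ← e']
  · refine ⟨0, ?_, by rw [map_zero, dif_neg h]⟩
    rw [map_zero]
    unfold bismashBrauerCharacter
    refine (Finset.sum_eq_zero fun t _ => ?_).symm
    have : actR hQ y t ≠ x := fun hyt =>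
      h ((hT y).unique ⟨hx, t, hyt⟩ ⟨hy, 1, actR_one hQ y⟩)
    simp only [if_neg this, dite_eq_ite, ite_self]

theorem isIrreducible_comp_inclusion {k Γ W : Type*} [Field k] [Group Γ] [AddCommGroup W]
    [Module k W] {A B : Subgroup Γ} (h : A = B) (ρ : Representation k B W) (hρ : ρ.IsIrreducible) :
    Representation.IsIrreducible (ρ.comp (Subgroup.inclusion h.le)) := by
  subst h
  exact hρ

/-- A relation over a discrete valuation ring can be divided by a coefficient that divides all the
others. -/
theorem linearIndependent_of_forall_coeff_one {D : Type*} [CommRing D] [IsDomain D]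
    [IsDiscreteValuationRing D] {V ι : Type*} [AddCommGroup V] [Module D V]
    [Module.IsTorsionFree D V] {v : ι → V}
    (h : ∀ (s : Finset ι) (c : ι → D), ∀ i ∈ s, c i = 1 → ∑ j ∈ s, c j • v j ≠ 0) :
    LinearIndependent D v := by
  classical
  rw [linearIndependent_iff']
  intro s c hc i hi
  by_contra hci
  obtain ⟨i₀, hi₀, hmin⟩ := Finset.exists_min_image s
    (fun j => IsDiscreteValuationRing.addVal D (c j)) ⟨i, hi⟩
  have hdvd : ∀ j ∈ s, c i₀ ∣ c j := fun j hj =>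
    (IsDiscreteValuationRing.addVal_le_iff_dvd).1 (hmin j hj)
  have hne : c i₀ ≠ 0 := fun h0 => hci (zero_dvd_iff.1 (h0 ▸ hdvd i hi))
  choose! d hd using hdvd
  have hd₀ : d i₀ = 1 := by
    have := hd i₀ hi₀
    exact (mul_eq_left₀ hne).1 this.symm
  refine h s d i₀ hi₀ hd₀ ?_
  rw [Finset.sum_congr rfl fun j hj => by rw [hd j hj, mul_smul], ← Finset.smul_sum] at hc
  exact (smul_eq_zero_iff_right hne).1 hc

end BismashBrauerCharacters

theorem mainTheorem5 {Q : Type*} [Group Q] {F G : Subgroup Q} [Fintype F] [Fintype G]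
    (hQ : F.IsComplement' G)
    (p : ℕ) [Fact p.Prime]
    (R : Type*) (K : Type*) [CommRing R] [IsDomain R] [IsDiscreteValuationRing R]
    [IsAdicComplete (IsLocalRing.maximalIdeal R) R]
    [Field K] [Algebra R K] [IsFractionRing R K]
    [CharP (IsLocalRing.ResidueField R) p] [Finite (IsLocalRing.ResidueField R)]
    (T : Set G) (hT : IsOrbitReps hQ T)
    (S : G → Finset F)
    (hS : ∀ x, Subgroup.IsComplement (S x : Set F) (stab hQ x : Set F))
    {ι : Type*} (M : ι → Type*) [∀ i, AddCommGroup (M i)]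
    [∀ i, Module (Bismash (IsLocalRing.ResidueField R) hQ) (M i)]
    (hM : ∀ i, IsSimpleModule (Bismash (IsLocalRing.ResidueField R) hQ) (M i))
    (hMM : ∀ i j, i ≠ j →
      IsEmpty (M i ≃ₗ[Bismash (IsLocalRing.ResidueField R) hQ] M j)) :
    ∃ φ : ι → BPrime p hQ → K,
      (∀ i ψ, IsBrauerCharacter R K p hQ T S (M i) ψ ↔ ψ = φ i) ∧
      LinearIndependent K φ := by
  classical
  choose x hx n ρ τ hnt hτ using fun i =>
    exists_isWeightEmbedding (E := IsLocalRing.ResidueField R) hT (M i)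
  have hirr : ∀ i, (ρ i).IsIrreducible := fun i => (hτ i).isIrreducible
  have hequiv : ∀ i,
      Nonempty (IndModule hQ (ρ i) ≃ₗ[Bismash (IsLocalRing.ResidueField R) hQ] M i) :=
    fun i => (hτ i).nonempty_equiv
  refine ⟨fun i => bismashBrauerCharacter K p hQ (S (x i)) (ρ i), fun i ψ => ⟨?_, ?_⟩, ?_⟩
  · rintro ⟨y, hy, n', ρ', hρ', ⟨e⟩, rfl⟩
    obtain ⟨e'⟩ := hequiv i
    have := hirr i
    exact (bismashBrauerCharacter_eq_of_indModule_equiv hT S (hx i) hy (e' ≪≫ₗ e.symm)).symm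
  · rintro rfl
    exact ⟨x i, hx i, n i, ρ i, hirr i, hequiv i, rfl⟩
  · rw [← LinearIndependent.iff_fractionRing R K]
    have : Module.IsTorsionFree R K := .of_smul_eq_zero fun r m h => by
      rw [Algebra.smul_def] at h
      exact (mul_eq_zero.1 h).imp_left fun h' =>
        IsFractionRing.injective R K (h'.trans (map_zero _).symm)
    refine linearIndependent_of_forall_coeff_one fun s c i₀ hi₀ hci₀ hsum => ?_
    have hne : ∀ i j (h : x i = x j), i ≠ j → ¬ ∃ l : (Fin (n i) → IsLocalRing.ResidueField R)
        ≃ₗ[IsLocalRing.ResidueField R] (Fin (n j) → IsLocalRing.ResidueField R),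
        ∀ (g : F) (hg : g ∈ stab hQ (x i)) v,
          l (ρ i ⟨g, hg⟩ v) = ρ j ⟨g, h ▸ hg⟩ (l v) := by
      rintro i j h hij ⟨l, hl⟩
      have h' : ∀ g : F, Bismash.basis hQ (x i) g =
          (Bismash.basis hQ (x j) g : Bismash (IsLocalRing.ResidueField R) hQ) := fun g => by
        rw [h]
      have hτl : IsWeightEmbedding (ρ i) ((τ j).comp l.toLinearMap.toAddMonoidHom) :=
        { injective := (hτ j).injective.comp l.injective
          map_smul := fun r w => by
            change τ j (l (r • w)) = algebraMap _ _ r • τ j (l w)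
            rw [map_smul, (hτ j).map_smul]
          map_rho := fun s w => by
            change τ j (l (ρ i s w)) = (Bismash.basis hQ (x i) (s : F) : Bismash _ hQ) • τ j (l w)
            rw [hl s s.2, (hτ j).map_rho, ← h'] }
      obtain ⟨e⟩ := hequiv i
      obtain ⟨e'⟩ := hτl.nonempty_equiv
      exact (hMM i j hij).false (e.symm ≪≫ₗ e')
    -- Evaluation at `p_{x i₀} # g` removes the modules that belong to other orbits.
    let J := {i // i ∈ s ∧ x i = x i₀}
    let _ : Fintype J := Fintype.subtype (s.filter fun i => x i = x i₀) (by simp)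
    have hJ : ∀ j : J, stab hQ (x i₀) = stab hQ (x j.1) := fun j => by rw [j.2.2]
    have h0 := eq_zero_of_sum_trace_eq_zero p (k := IsLocalRing.ResidueField R)
      (fun j : J => Fin (n j.1) → IsLocalRing.ResidueField R)
      (fun j : J => (ρ j.1).comp (Subgroup.inclusion (hJ j).le))
      (fun j => isIrreducible_comp_inclusion (hJ j) _ (hirr j.1)) ?_
      (fun j => IsLocalRing.residue R (c j.1)) ?_ ⟨i₀, hi₀, rfl⟩
    · rw [hci₀, map_one] at h0
      exact one_ne_zero h0
    · rintro i j hij ⟨l, hl⟩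
      refine hne i.1 j.1 (i.2.2.trans j.2.2.symm) (fun h => hij (Subtype.ext h))
        ⟨l, fun g hg v => hl ⟨g, (hJ i).ge hg⟩ v⟩
    · intro g hg
      have hreg : IsOfFinOrder (g : F) ∧ (orderOf (g : F)).Coprime p :=
        ⟨isOfFinOrder_of_finite _, by rwa [Subgroup.orderOf_coe]⟩
      choose r hr hres using fun i => exists_residue_eq_bismashBrauerCharacter (K := K) hT (hx i)
        (hx i₀) (hS (x i)) (ρ i) (g : F) g.2 hreg
      have hR : ∑ i ∈ s, c i * r i = 0 := by
        apply IsFractionRing.injective R K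
        have h := congrArg (LinearMap.proj (R := R) (φ := fun _ : BPrime p hQ => K)
          ⟨(x i₀, (g : F)), g.2, hreg⟩) hsum
        rw [map_sum, map_zero] at h
        rw [map_zero, map_sum, ← h]
        refine Finset.sum_congr rfl fun i _ => ?_
        rw [map_mul, hr, map_smul, Algebra.smul_def]
        rfl
      have hk := congrArg (IsLocalRing.residue R) hR
      rw [map_zero, map_sum] at hk
      rw [← hk]
      rw [← Finset.sum_filter_of_ne (s := s) (p := fun i => x i = x i₀),
        Finset.sum_subtype (p := fun i => i ∈ s ∧ x i = x i₀) _ (by simp)]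
      · refine Finset.sum_congr rfl fun j _ => ?_
        rw [map_mul, hres, dif_pos j.2.2]
        rfl
      · intro i _ hi
        by_contra hxi
        rw [map_mul, hres, dif_neg hxi, mul_zero] at hi
        exact hi rfl
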